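/- Let $\mathbb F$ be a finite field with $q$ elements and characteristic $p$, let $A=\mathbb F[\theta]$ and $F=\mathbb F(\theta)$, let $A_{+,n}$ be the set of monic polynomials of degree $n$ in $A$, and let $\mathfrak p\subset A$ be a nonzero prime ideal with monic generator $\pi_{\mathfrak p}$ of degree $d$. Let $A_{\mathfrak p}$ be the completion of $A$ at $\mathfrak p$, let $\omega_{\mathfrak p}\colon A_{\mathfrak p}\to A_{\mathfrak p}$ be the Teichmüller character (the reduction $A_{\mathfrak p}\to A/\mathfrak p$ followed by the canonical ring section $A/\mathfrak p\to A_{\mathfrak p}$), and write $a=\omega_{\mathfrak p}(a)\langle a\rangle_{\mathfrak p}$ for $a\in A_{\mathfrak p}^*$, so that $\langle a\rangle_{\mathfrak p}\in 1+\mathfrak pA_{\mathfrak p}$. For $s=(y,i)\in\mathbb Z_p\times\mathbb Z/(q^d-1)$ put $a^s=\omega_{\mathfrak p}(a)^i\langle a\rangle_{\mathfrak p}^y$. Let $\Phi$ be the Carlitz module, $\Phi_\theta=\theta\tau^0+\tau$, let $F(\Phi[\mathfrak p^\infty])$ be the field generated over $F$ by its $\mathfrak p$-power torsion, $G_\infty$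 its Galois group over $F$, and $\kappa\colon G_\infty\to A_{\mathfrak p}^*$ the cyclotomic character, defined by $\sigma(\varepsilon)=\Phi_{\kappa(\sigma)}(\varepsilon)$ for $\varepsilon\in\Phi[\mathfrak p^\infty]$. Let $S=\{\mathfrak p,\infty\}$, let $\mathcal F_S$ be the maximal abelian extension of $F$ unramified outside $S$, $G_S=\mathrm{Gal}(\mathcal F_S/F)$, and for a place $\mathfrak q\notin S$ let $\mathrm{Fr}_{\mathfrak q}\in G_S$ be the arithmetic Frobenius. Define $\xi_s\colon G_S\to A_{\mathfrak p}^*$ by $\xi_s(\sigma)=\kappa(\sigma|_{F(\Phi[\mathfrak p^\infty])})^s$, and extend it linearly and coefficientwise to $\mathbb Z[G_S][[X]]\to A_{\mathfrak p}[[X]]$. Let $$\Theta_{\mathcal F_S/F,S}(X)=\prod_{\mathfrak q\notin S}\bigl(1-\mathrm{Fr}_{\mathfrak q}^{-1}X^{\deg\mathfrak q}\bigr)^{-1}\in\mathbb Z[G_S][[X]],$$ $$L_{\mathfrak p}(X,y,\omega_{\mathfrak p}^i)=\sum_{n\ge0}\Bigl(\sum_{a\in A_{+,n}\setminus\mathfrak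 p}\omega_{\mathfrak p}(a)^i\langle a\rangle_{\mathfrak p}^y\Bigr)X^n\in A_{\mathfrak p}[[X]],\qquad Z(X,j)=\sum_{n\ge0}\Bigl(\sum_{a\in A_{+,n}}a^j\Bigr)X^n\quad(j\ge0).$$ 1. For every $s=(y,i)\in\mathbb Z_p\times\mathbb Z/(q^d-1)$ one has $\xi_{-s}(\Theta_{\mathcal F_S/F,S})(X)=L_{\mathfrak p}(X,y,\omega_{\mathfrak p}^i)$. 2. For every integer $j\ge0$ with $j\equiv i \pmod{q^d-1}$, the series $Z(X,j)$ is a polynomial in $A[X]$ and $L_{\mathfrak p}(X,j,\omega_{\mathfrak p}^i)=(1-\pi_{\mathfrak p}^jX^d)\,Z(X,j)\in A[X]$. 3. For every $y\in\mathbb Z_p$ and every integer $1\le i\le q^d-2$ one has $L_{\mathfrak p}(X,y,\omega_{\mathfrak p}^i)\equiv Z(X,i)\pmod{\mathfrak p}$; for $i=0$ and every $y\in\mathbb Z_p$ one has $L_{\mathfrak p}(X,y,\omega_{\mathfrak p}^0)\equiv(1-X^d)\,Z(X,0)\pmod{\mathfrak p}$. Congruences are coefficientwise. -/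

import Mathlib

open scoped Polynomial

namespace PadicGoss

noncomputable section

section Setup

variable (𝔽 : Type*) [Field 𝔽]

/-- The rational function field `F = 𝔽(θ)`; the ring `A = 𝔽[θ]` is `𝔽[X]`. -/
abbrev RatField : Type _ := RatFunc 𝔽

/-- The fixed algebraic closure of `F`. -/
abbrev FBar : Type _ := AlgebraicClosure (RatField 𝔽)

/-- The operator `Φ_θ = θ τ⁰ + τ` of the Carlitz module on the algebraic closure of `F`, that is
`x ↦ θ x + x ^ q`, where `q = #𝔽`. -/
def carlitzTheta [Fintype 𝔽] : Module.End 𝔽 (FBar 𝔽) :=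
  LinearMap.mulLeft 𝔽 (algebraMap 𝔽[X] (FBar 𝔽) Polynomial.X) +
    (FiniteField.frobeniusAlgHom 𝔽 (FBar 𝔽)).toLinearMap

/-- The Carlitz module: the `𝔽`-algebra homomorphism `a ↦ Φ_a` with `Φ_θ = θ τ⁰ + τ`, the additive
polynomial `Φ_a` being regarded as an operator on the algebraic closure of `F`. -/
def carlitz [Fintype 𝔽] : 𝔽[X] →ₐ[𝔽] Module.End 𝔽 (FBar 𝔽) := Polynomial.aeval (carlitzTheta 𝔽)

variable {𝔽}

/-- The `I`-torsion `Φ[I]` of the Carlitz module. -/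
def carlitzTorsion [Fintype 𝔽] (I : Ideal 𝔽[X]) : Set (FBar 𝔽) := {x | ∀ a ∈ I, carlitz 𝔽 a x = 0}

/-- `P` is the monic generator of a nonzero prime ideal of `𝔽[X]`. -/
class IsMonicPrime (P : 𝔽[X]) : Prop where
  monic : P.Monic
  irreducible : Irreducible P

/-- The prime ideal `𝔭 = (P)`. -/
abbrev primeIdeal (P : 𝔽[X]) : Ideal 𝔽[X] := Ideal.span {P}

/-- The field `F(Φ[𝔭^∞])`, the `𝔭`-cyclotomic extension of `F`. -/
def cyclotomicField [Fintype 𝔽] (P : 𝔽[X]) : IntermediateField (RatField 𝔽) (FBar 𝔽) :=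
  ⨆ n : ℕ, IntermediateField.adjoin (RatField 𝔽) (carlitzTorsion (primeIdeal P ^ n))

/-- The places of `F` outside `S = {𝔭, ∞}`: the primes of `𝔽[X]` other than `𝔭`, each given by its
monic generator. The degree of such a place is the degree of the generator. -/
abbrev Place (P : 𝔽[X]) : Type _ := {Q : 𝔽[X] // IsMonicPrime Q ∧ Q ≠ P}

/-- `E/F` is unramified outside `S = {𝔭, ∞}`. -/
def UnramifiedOutside (P : 𝔽[X]) (E : IntermediateField (RatField 𝔽) (FBar 𝔽)) : Prop :=
  ∀ Q : Place P, ∀ (𝔔 : Ideal (integralClosure 𝔽[X] E)) [𝔔.IsPrime],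
    𝔔.LiesOver (primeIdeal Q.1) → Algebra.IsUnramifiedAt 𝔽[X] 𝔔

/-- The finite abelian extensions of `F` unramified outside `S`. -/
def abelianUnramified (P : 𝔽[X]) : Set (IntermediateField (RatField 𝔽) (FBar 𝔽)) :=
  {E | FiniteDimensional (RatField 𝔽) E ∧ IsAbelianGalois (RatField 𝔽) E ∧ UnramifiedOutside P E}

/-- `F_S`, the maximal abelian extension of `F` unramified outside `S = {𝔭, ∞}`: the compositum of
all finite ones. -/
def maxAbelian (P : 𝔽[X]) : IntermediateField (RatField 𝔽) (FBar 𝔽) := sSup (abelianUnramified P)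

/-- `G_S = Gal(F_S/F)`. -/
abbrev GS (P : 𝔽[X]) : Type _ := Gal(maxAbelian P/RatField 𝔽)

/-- `G_∞ = Gal(F(Φ[𝔭^∞])/F)`. -/
abbrev GInf [Fintype 𝔽] (P : 𝔽[X]) : Type _ := Gal(cyclotomicField P/RatField 𝔽)

theorem GS_comm (P : 𝔽[X]) (σ τ : GS P) : σ * τ = τ * σ := by
  let K : IntermediateField (RatField 𝔽) (maxAbelian P) :=
    { AlgHom.equalizer ((σ * τ : GS P) : maxAbelian P →ₐ[RatField 𝔽] maxAbelian P)
        ((τ * σ : GS P) : maxAbelian P →ₐ[RatField 𝔽] maxAbelian P) with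
      inv_mem' := fun x hx => by
        have hx' : (σ * τ) x = (τ * σ) x := hx
        change (σ * τ) x⁻¹ = (τ * σ) x⁻¹
        rw [map_inv₀, map_inv₀, hx'] }
  have key : maxAbelian P ≤ K.map (maxAbelian P).val := by
    refine sSup_le fun E hE => ?_
    have hle : E ≤ maxAbelian P := le_sSup hE
    obtain ⟨-, hab, -⟩ := hE
    let _ : Algebra E (maxAbelian P) := (IntermediateField.inclusion hle).toRingHom.toAlgebra
    have : IsScalarTower (RatField 𝔽) E (maxAbelian P) :=
      IsScalarTower.of_algebraMap_eq' (IntermediateField.inclusion hle).comp_algebraMap.symm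
    intro x hx
    refine ⟨⟨x, hle hx⟩, ?_, rfl⟩
    change (σ * τ) (algebraMap E (maxAbelian P) ⟨x, hx⟩) =
      (τ * σ) (algebraMap E (maxAbelian P) ⟨x, hx⟩)
    rw [← AlgEquiv.restrictNormal_commutes, ← AlgEquiv.restrictNormal_commutes]
    congr 2
    change AlgEquiv.restrictNormalHom E (σ * τ) = AlgEquiv.restrictNormalHom E (τ * σ)
    rw [map_mul, map_mul]
    exact hab.toIsMulCommutative.is_comm.comm _ _
  refine AlgEquiv.ext fun x => ?_
  obtain ⟨z, hz, hzx⟩ := key x.2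
  have : z = x := Subtype.ext hzx
  subst this
  exact hz

instance (P : 𝔽[X]) : CommGroup (GS P) := { (inferInstance : Group (GS P)) with mul_comm := GS_comm P }

/-- `σ` is the (arithmetic) Frobenius automorphism of `F_S/F` at `Q`: it acts as
`x ↦ x ^ #(A/(Q))` modulo every prime of `F_S` above `Q`. -/
def IsFrobenius (P : 𝔽[X]) (Q : Place P) (σ : GS P) : Prop :=
  ∀ (𝔔 : Ideal (integralClosure 𝔽[X] (maxAbelian P))) [𝔔.IsPrime],
    𝔔.LiesOver (primeIdeal Q.1) → IsArithFrobAt 𝔽[X] σ 𝔔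

/-- The Frobenius `Fr_Q ∈ G_S`. -/
def frob (P : 𝔽[X]) (Q : Place P) : GS P := Classical.epsilon (IsFrobenius P Q)

end Setup

section Stickelberger

variable {𝔽 : Type*} [Field 𝔽]

/-- The polynomials of degree at most `n` over a finite field form a finite set. -/
theorem finite_natDegree_le [Fintype 𝔽] (n : ℕ) : {a : 𝔽[X] | a.natDegree ≤ n}.Finite := by
  have h : {a : 𝔽[X] | a.natDegree ≤ n} ⊆
      Set.range fun c : Fin (n + 1) → 𝔽 => ∑ i : Fin (n + 1), Polynomial.monomial i (c i) := by
    intro a ha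
    refine ⟨fun i => a.coeff i, ?_⟩
    conv_rhs => rw [a.as_sum_range' (n + 1) (Nat.lt_succ_of_le ha)]
    exact Fin.sum_univ_eq_sum_range (fun i => Polynomial.monomial i (a.coeff i)) (n + 1)
  exact (Set.finite_range _).subset h

/-- `A_{+,n}`: the monic polynomials of degree `n`. -/
def monicsOfDegree (𝔽 : Type*) [Field 𝔽] [Fintype 𝔽] (n : ℕ) : Finset 𝔽[X] :=
  ((finite_natDegree_le n).subset
    (fun _ h => h.2.le : {a : 𝔽[X] | a.Monic ∧ a.natDegree = n} ⊆ _)).toFinset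

@[simp] theorem mem_monicsOfDegree [Fintype 𝔽] {n : ℕ} {a : 𝔽[X]} :
    a ∈ monicsOfDegree 𝔽 n ↔ a.Monic ∧ a.natDegree = n := by
  simp [monicsOfDegree]

/-- The (finitely many) places outside `S` of degree at most `n`. -/
def placesUpTo [Fintype 𝔽] (P : 𝔽[X]) (n : ℕ) : Finset (Place P) :=
  ((finite_natDegree_le n).preimage
    (Subtype.val_injective.injOn : Set.InjOn (Subtype.val : Place P → 𝔽[X]) _)).toFinset

@[simp] theorem mem_placesUpTo [Fintype 𝔽] {P : 𝔽[X]} {n : ℕ} {Q : Place P} :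
    Q ∈ placesUpTo P n ↔ Q.1.natDegree ≤ n := by
  simp [placesUpTo]

/-- The Euler factor `(1 - Fr_Q⁻¹ X ^ deg Q)⁻¹` in `ℤ[G_S][[X]]`. -/
def eulerFactor (P : 𝔽[X]) (Q : Place P) : PowerSeries (MonoidAlgebra ℤ (GS P)) :=
  PowerSeries.invOfUnit
    (1 - PowerSeries.monomial Q.1.natDegree (MonoidAlgebra.of ℤ (GS P) (frob P Q)⁻¹)) 1

/-- The Stickelberger series `∏_{Q ∉ S} (1 - Fr_Q⁻¹ X ^ deg Q)⁻¹ ∈ ℤ[G_S][[X]]`. The places of degree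
greater than `n` do not contribute to the coefficient of `X ^ n`, so that coefficient is the
one of the finite product over the places of degree at most `n`. -/
def stickelberger [Fintype 𝔽] (P : 𝔽[X]) : PowerSeries (MonoidAlgebra ℤ (GS P)) :=
  PowerSeries.mk fun n => PowerSeries.coeff n (∏ Q ∈ placesUpTo P n, eulerFactor P Q)

/-- `(1 - Fr_Q⁻¹ X ^ deg Q)` and the Euler factor are inverse to each other. -/
theorem mul_eulerFactor (P : 𝔽[X]) (Q : Place P) :
    (1 - PowerSeries.monomial Q.1.natDegree (MonoidAlgebra.of ℤ (GS P) (frob P Q)⁻¹)) *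
      eulerFactor P Q = 1 := by
  apply PowerSeries.mul_invOfUnit
  have h : Q.1.natDegree ≠ 0 := Q.2.1.irreducible.natDegree_pos.ne'
  rw [map_sub, map_one, ← PowerSeries.coeff_zero_eq_constantCoeff_apply,
    PowerSeries.coeff_monomial, if_neg (Ne.symm h)]
  simp

/-- Enlarging the finite set of places does not change the coefficient of `X ^ n`, so
`stickelberger P` is the infinite product. -/
theorem coeff_stickelberger [Fintype 𝔽] (P : 𝔽[X]) (n : ℕ) (T : Finset (Place P)) (hT : placesUpTo P n ⊆ T) :
    PowerSeries.coeff n (∏ Q ∈ T, eulerFactor P Q) = PowerSeries.coeff n (stickelberger P) := by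
  classical
  set I : Ideal (PowerSeries (MonoidAlgebra ℤ (GS P))) := Ideal.span {PowerSeries.X ^ (n + 1)} with hI
  have hfac : ∀ Q ∈ T \ placesUpTo P n, Ideal.Quotient.mk I (eulerFactor P Q) = 1 := by
    intro Q hQ
    have hdeg : n + 1 ≤ Q.1.natDegree := by
      simpa using (Finset.mem_sdiff.1 hQ).2
    have hmon : Ideal.Quotient.mk I (PowerSeries.monomial Q.1.natDegree
        (MonoidAlgebra.of ℤ (GS P) (frob P Q)⁻¹)) = 0 := by
      rw [Ideal.Quotient.eq_zero_iff_mem, hI, Ideal.mem_span_singleton, PowerSeries.X_pow_dvd_iff]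
      intro m hm
      rw [PowerSeries.coeff_monomial, if_neg (by omega)]
    have := congrArg (Ideal.Quotient.mk I) (mul_eulerFactor P Q)
    simpa only [map_mul, map_sub, map_one, hmon, sub_zero, one_mul] using this
  have hmk : Ideal.Quotient.mk I (∏ Q ∈ T, eulerFactor P Q) =
      Ideal.Quotient.mk I (∏ Q ∈ placesUpTo P n, eulerFactor P Q) := by
    rw [← Finset.prod_sdiff hT, map_mul, map_prod, Finset.prod_eq_one hfac, one_mul]
  rw [Ideal.Quotient.eq, hI, Ideal.mem_span_singleton, PowerSeries.X_pow_dvd_iff] at hmk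
  have := hmk n (Nat.lt_succ_self n)
  rw [map_sub, sub_eq_zero] at this
  rw [this, stickelberger, PowerSeries.coeff_mk]

end Stickelberger

section Completion

variable {𝔽 : Type*} [Field 𝔽]

/-- `A_𝔭`, the completion of `A = 𝔽[X]` at `𝔭 = (P)`. -/
abbrev Ap (P : 𝔽[X]) : Type _ := AdicCompletion (primeIdeal P) 𝔽[X]

/-- The reduction `A_𝔭 → A/𝔭^n`. -/
abbrev red (P : 𝔽[X]) (n : ℕ) : Ap P →ₐ[𝔽[X]] 𝔽[X] ⧸ primeIdeal P ^ n :=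
  AdicCompletion.evalₐ (primeIdeal P) n

theorem factorPow_red (P : 𝔽[X]) {m n : ℕ} (h : m ≤ n) (a : Ap P) :
    Ideal.Quotient.factorPow (primeIdeal P) h (red P n a) = red P m a := by
  obtain ⟨x, rfl⟩ := AdicCompletion.mk_surjective (primeIdeal P) 𝔽[X] a
  rw [AdicCompletion.evalₐ_mk, AdicCompletion.evalₐ_mk]
  exact AdicCompletion.Ideal.mk_eq_mk (primeIdeal P) h x

/-- A compatible family of monoid homomorphisms `G → A/𝔭^n` defines one `G → A_𝔭`. -/
def liftMonoidHom {G : Type*} [Monoid G] (P : 𝔽[X]) (f : ∀ n, G →* 𝔽[X] ⧸ primeIdeal P ^ n)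
    (hf : ∀ {m n : ℕ} (h : m ≤ n) (g : G),
      Ideal.Quotient.factorPow (primeIdeal P) h (f n g) = f m g) : G →* Ap P :=
  ((AdicCompletion.liftRingHom (primeIdeal P)
      (fun n => ((MonoidAlgebra.lift ℤ (𝔽[X] ⧸ primeIdeal P ^ n) G (f n) :
        MonoidAlgebra ℤ G →ₐ[ℤ] 𝔽[X] ⧸ primeIdeal P ^ n) :
          MonoidAlgebra ℤ G →+* 𝔽[X] ⧸ primeIdeal P ^ n))
      (fun {m n} h => by
        refine MonoidAlgebra.ringHom_ext (fun r => ?_) (fun g => ?_)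
        · simp
        · simpa using hf h g) : MonoidAlgebra ℤ G →+* Ap P) : MonoidAlgebra ℤ G →* Ap P).comp
    (MonoidAlgebra.of ℤ G)

@[simp] theorem red_liftMonoidHom {G : Type*} [Monoid G] (P : 𝔽[X])
    (f : ∀ n, G →* 𝔽[X] ⧸ primeIdeal P ^ n)
    (hf : ∀ {m n : ℕ} (h : m ≤ n) (g : G),
      Ideal.Quotient.factorPow (primeIdeal P) h (f n g) = f m g) (g : G) (n : ℕ) :
    red P n (liftMonoidHom P f hf g) = f n g := by
  have := AdicCompletion.evalₐ_liftRingHom (primeIdeal P)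
    (fun n => ((MonoidAlgebra.lift ℤ (𝔽[X] ⧸ primeIdeal P ^ n) G (f n) :
        MonoidAlgebra ℤ G →ₐ[ℤ] 𝔽[X] ⧸ primeIdeal P ^ n) :
          MonoidAlgebra ℤ G →+* 𝔽[X] ⧸ primeIdeal P ^ n))
    (fun {m n} h => by
        refine MonoidAlgebra.ringHom_ext (fun r => ?_) (fun g => ?_)
        · simp
        · simpa using hf h g) n (MonoidAlgebra.of ℤ G g)
  refine this.trans ?_
  simp

end Completion

section Characters

variable {𝔽 : Type*} [Field 𝔽] [Fintype 𝔽] (P : 𝔽[X]) [hP : IsMonicPrime P]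

theorem pow_card_sub_mem (a : 𝔽[X]) :
    a ^ Fintype.card 𝔽 ^ P.natDegree - a ∈ primeIdeal P := by
  have : (primeIdeal P).IsMaximal := PrincipalIdealRing.isMaximal_of_irreducible hP.irreducible
  let _ : Field (𝔽[X] ⧸ primeIdeal P) := Ideal.Quotient.field _
  have : Module.Finite 𝔽 (𝔽[X] ⧸ primeIdeal P) := hP.monic.finite_quotient
  have : Finite (𝔽[X] ⧸ primeIdeal P) := Module.finite_of_finite 𝔽
  have hc : Nat.card (𝔽[X] ⧸ primeIdeal P) = Fintype.card 𝔽 ^ P.natDegree := by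
    rw [Module.natCard_eq_pow_finrank (K := 𝔽), finrank_quotient_span_eq_natDegree,
      Nat.card_eq_fintype_card]
  rw [← Ideal.Quotient.eq, map_pow, ← hc]
  have := Fintype.ofFinite (𝔽[X] ⧸ primeIdeal P)
  rw [Nat.card_eq_fintype_card]
  exact FiniteField.pow_card _

/-- The iterated Frobenius `x ↦ x ^ (q ^ k)` of an `𝔽`-algebra. -/
abbrev frobPow (𝔽 : Type*) [Field 𝔽] [Fintype 𝔽] (R : Type*) [CommRing R] [Algebra 𝔽 R] (k : ℕ) :
    R →+* R := ((FiniteField.frobeniusAlgHom 𝔽 R ^ k : R →ₐ[𝔽] R) : R →+* R)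

theorem frobPow_apply (R : Type*) [CommRing R] [Algebra 𝔽 R] (k : ℕ) (x : R) :
    frobPow 𝔽 R k x = x ^ Fintype.card 𝔽 ^ k := by
  simp only [frobPow, AlgHom.coe_toRingHom, AlgHom.coe_pow, FiniteField.coe_frobeniusAlgHom,
    pow_iterate]

theorem pow_stable {m n : ℕ} (h : m ≤ n) (x : 𝔽[X] ⧸ primeIdeal P ^ m) :
    x ^ Fintype.card 𝔽 ^ (P.natDegree * n) = x ^ Fintype.card 𝔽 ^ (P.natDegree * m) := by
  induction n, h using Nat.le_induction with
  | base => rfl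
  | succ n hmn ih =>
    rw [← ih]
    obtain ⟨a, rfl⟩ := Ideal.Quotient.mk_surjective x
    rw [← map_pow, ← map_pow, Ideal.Quotient.eq]
    have e : a ^ Fintype.card 𝔽 ^ (P.natDegree * (n + 1)) - a ^ Fintype.card 𝔽 ^ (P.natDegree * n) =
        (a ^ Fintype.card 𝔽 ^ P.natDegree - a) ^ Fintype.card 𝔽 ^ (P.natDegree * n) := by
      rw [← frobPow_apply 𝔽[X] (P.natDegree * n) (_ - a), map_sub, frobPow_apply, frobPow_apply,
        ← pow_mul, ← pow_add]
      ring_nf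
    rw [e]
    have hn : m ≤ Fintype.card 𝔽 ^ (P.natDegree * n) :=
      calc m ≤ n := hmn
        _ ≤ P.natDegree * n := Nat.le_mul_of_pos_left _ hP.irreducible.natDegree_pos
        _ ≤ _ := (Nat.lt_pow_self Fintype.one_lt_card).le
    exact Ideal.pow_le_pow_right hn (Ideal.pow_mem_pow (pow_card_sub_mem P a) _)

theorem teichmuller_compat {m n : ℕ} (h : m ≤ n) :
    (Ideal.Quotient.factorPow (primeIdeal P) h).comp
        ((frobPow 𝔽 (𝔽[X] ⧸ primeIdeal P ^ n) (P.natDegree * n)).comp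
          (red P n : Ap P →+* 𝔽[X] ⧸ primeIdeal P ^ n)) =
      (frobPow 𝔽 (𝔽[X] ⧸ primeIdeal P ^ m) (P.natDegree * m)).comp
        (red P m : Ap P →+* 𝔽[X] ⧸ primeIdeal P ^ m) := by
  ext a
  rw [RingHom.comp_apply, RingHom.comp_apply, RingHom.comp_apply, frobPow_apply, frobPow_apply,
    map_pow]
  change Ideal.Quotient.factorPow (primeIdeal P) h (red P n a) ^ _ = red P m a ^ _
  rw [factorPow_red]
  exact pow_stable P h _

/-- The Teichmüller character `ω_𝔭 : A_𝔭 → A_𝔭`, namely `ω_𝔭(a) = lim a ^ (q ^ (d n))`, where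
`d = deg P`. It is the composite of the reduction `A_𝔭 → A/𝔭` with the lift `A/𝔭 → A_𝔭`, see
`teichmuller_congr` and `teichmuller_pow_card`. -/
def teichmuller : Ap P →+* Ap P :=
  AdicCompletion.liftRingHom (primeIdeal P)
    (fun n => (frobPow 𝔽 (𝔽[X] ⧸ primeIdeal P ^ n) (P.natDegree * n)).comp
      (red P n : Ap P →+* 𝔽[X] ⧸ primeIdeal P ^ n))
    (teichmuller_compat P)

theorem red_teichmuller (n : ℕ) (a : Ap P) :
    red P n (teichmuller P a) = red P n a ^ Fintype.card 𝔽 ^ (P.natDegree * n) := by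
  have h := AdicCompletion.evalₐ_liftRingHom (primeIdeal P)
    (fun n => (frobPow 𝔽 (𝔽[X] ⧸ primeIdeal P ^ n) (P.natDegree * n)).comp
      (red P n : Ap P →+* 𝔽[X] ⧸ primeIdeal P ^ n)) (teichmuller_compat P) n a
  exact h.trans (frobPow_apply _ _ _)

/-- `ω_𝔭(a) ≡ a` modulo `𝔭`. -/
theorem teichmuller_congr (a : Ap P) : red P 1 (teichmuller P a) = red P 1 a := by
  rw [red_teichmuller]
  obtain ⟨b, hb⟩ := Ideal.Quotient.mk_surjective (red P 1 a)
  rw [← hb, ← map_pow, Ideal.Quotient.eq, mul_one, pow_one]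
  exact pow_card_sub_mem P b

/-- `ω_𝔭(a)` is a root of `x ^ (q ^ d) = x`. -/
theorem teichmuller_pow_card (a : Ap P) :
    teichmuller P a ^ Fintype.card 𝔽 ^ P.natDegree = teichmuller P a := by
  refine AdicCompletion.ext_evalₐ fun n => ?_
  have h := pow_stable P (Nat.le_succ n) (red P n a)
  rw [map_pow]
  change red P n (teichmuller P a) ^ _ = red P n (teichmuller P a)
  rw [red_teichmuller, ← pow_mul, ← pow_add, ← h, Nat.mul_succ]

/-- The projection `a ↦ ⟨a⟩_𝔭 = a / ω_𝔭(a)` of `A_𝔭ˣ` to its `1`-units. -/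
def oneUnit : (Ap P)ˣ →* (Ap P)ˣ :=
  MonoidHom.id _ / Units.map (teichmuller P : Ap P →* Ap P)

theorem red_oneUnit (a : (Ap P)ˣ) : red P 1 (oneUnit P a : Ap P) = 1 := by
  have h : (oneUnit P a : Ap P) * teichmuller P a = a := by
    have : oneUnit P a * Units.map (teichmuller P : Ap P →* Ap P) a = a := by
      simp [oneUnit]
    exact congrArg Units.val this
  have h2 := congrArg (red P 1) h
  rw [map_mul, teichmuller_congr] at h2
  exact (a.isUnit.map (red P 1)).mul_right_cancel (h2.trans (one_mul _).symm)

variable {p : ℕ} [Fact p.Prime] [CharP 𝔽 p]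

theorem oneUnit_pow (a : (Ap P)ˣ) (n : ℕ) : red P n (oneUnit P a : Ap P) ^ p ^ n = 1 := by
  rcases Nat.eq_zero_or_pos n with rfl | hn
  · have : Subsingleton (𝔽[X] ⧸ primeIdeal P ^ 0) := by
      rw [pow_zero, Ideal.one_eq_top]
      infer_instance
    exact Subsingleton.elim _ _
  obtain ⟨b, hb⟩ := Ideal.Quotient.mk_surjective (red P n (oneUnit P a : Ap P))
  have h1 : b - 1 ∈ primeIdeal P := by
    have h := factorPow_red P hn (oneUnit P a : Ap P)
    rw [red_oneUnit, ← hb] at h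
    have h' : Ideal.Quotient.mk (primeIdeal P ^ 1) b = Ideal.Quotient.mk (primeIdeal P ^ 1) 1 := h
    rw [Ideal.Quotient.eq, pow_one] at h'
    exact h'
  rw [← hb, ← map_pow, ← map_one (Ideal.Quotient.mk (primeIdeal P ^ n)), Ideal.Quotient.eq]
  have e : b ^ p ^ n - 1 = (b - 1) ^ p ^ n := by
    rw [sub_pow_char_pow, one_pow]
  rw [e]
  exact Ideal.pow_le_pow_right (Nat.lt_pow_self (Fact.out : p.Prime).one_lt).le
    (Ideal.pow_mem_pow h1 _)

theorem oneUnit_pow_congr (a : (Ap P)ˣ) {n k l : ℕ} (h : p ^ n ∣ k - l) (hkl : l ≤ k) :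
    red P n (oneUnit P a : Ap P) ^ k = red P n (oneUnit P a : Ap P) ^ l := by
  obtain ⟨c, hc⟩ := h
  obtain rfl : k = p ^ n * c + l := by omega
  rw [pow_add, pow_mul, oneUnit_pow, one_pow, one_mul]

theorem oneUnitPow_compat (y : ℤ_[p]) {m n : ℕ} (h : m ≤ n) (a : (Ap P)ˣ) :
    Ideal.Quotient.factorPow (primeIdeal P) h
      (((powMonoidHom (y.appr n)).comp ((red P n : Ap P →* 𝔽[X] ⧸ primeIdeal P ^ n).comp
        ((Units.coeHom (Ap P)).comp (oneUnit P)))) a) =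
      ((powMonoidHom (y.appr m)).comp ((red P m : Ap P →* 𝔽[X] ⧸ primeIdeal P ^ m).comp
        ((Units.coeHom (Ap P)).comp (oneUnit P)))) a := by
  simp only [MonoidHom.comp_apply, powMonoidHom_apply, Units.coeHom_apply, map_pow]
  change Ideal.Quotient.factorPow (primeIdeal P) h (red P n (oneUnit P a : Ap P)) ^ _ =
    red P m (oneUnit P a : Ap P) ^ _
  rw [factorPow_red]
  exact oneUnit_pow_congr P a (PadicInt.dvd_appr_sub_appr y m n h) (PadicInt.appr_mono y h)

/-- `a ↦ ⟨a⟩_𝔭 ^ y` for `y ∈ ℤ_p`: the limit of `⟨a⟩_𝔭 ^ m` as the natural number `m` tends to `y`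
in `ℤ_p`. Modulo `𝔭 ^ n` the exponent `y` may be replaced by any natural number congruent to it
modulo `p ^ n`. -/
def oneUnitPow (y : ℤ_[p]) : (Ap P)ˣ →* (Ap P)ˣ :=
  (liftMonoidHom P
    (fun n => (powMonoidHom (y.appr n)).comp
      ((red P n : Ap P →* 𝔽[X] ⧸ primeIdeal P ^ n).comp
        ((Units.coeHom (Ap P)).comp (oneUnit P))))
    (oneUnitPow_compat P y)).toHomUnits

theorem red_oneUnitPow (y : ℤ_[p]) (a : (Ap P)ˣ) (n : ℕ) :
    red P n (oneUnitPow P y a : Ap P) = red P n (oneUnit P a : Ap P) ^ y.appr n :=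
  red_liftMonoidHom P (fun n => (powMonoidHom (y.appr n)).comp
    ((red P n : Ap P →* 𝔽[X] ⧸ primeIdeal P ^ n).comp
      ((Units.coeHom (Ap P)).comp (oneUnit P)))) (oneUnitPow_compat P y) a n

/-- For a natural number `m` this is the usual power. -/
theorem oneUnitPow_natCast (m : ℕ) (a : (Ap P)ˣ) :
    oneUnitPow P (m : ℤ_[p]) a = oneUnit P a ^ m := by
  refine Units.ext (AdicCompletion.ext_evalₐ fun n => ?_)
  rw [Units.val_pow_eq_pow_val, map_pow]
  refine (red_oneUnitPow P _ a n).trans ?_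
  have h : ((m : ℤ_[p]).appr n : ZMod (p ^ n)) = (m : ZMod (p ^ n)) := by
    have : PadicInt.toZModPow n (m : ℤ_[p]) = ((m : ℤ_[p]).appr n : ZMod (p ^ n)) := rfl
    rw [← this, map_natCast]
  rw [ZMod.natCast_eq_natCast_iff] at h
  rcases le_total m ((m : ℤ_[p]).appr n) with hle | hle
  · exact oneUnit_pow_congr P a ((Nat.modEq_iff_dvd' hle).1 h.symm) hle
  · exact (oneUnit_pow_congr P a ((Nat.modEq_iff_dvd' hle).1 h) hle).symm

/-- The exponents `s = (y, i)` with `y ∈ ℤ_p` and `i ∈ ℤ/(q ^ d - 1)`. -/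
abbrev Exponent (P : 𝔽[X]) (p : ℕ) [Fact p.Prime] : Type :=
  ℤ_[p] × ZMod (Fintype.card 𝔽 ^ P.natDegree - 1)

/-- The quasi-character `a ↦ a ^ s = ω_𝔭(a) ^ i ⟨a⟩_𝔭 ^ y` of `A_𝔭ˣ`, where `s = (y, i)`. -/
def quasiChar (s : Exponent P p) : (Ap P)ˣ →* (Ap P)ˣ :=
  Units.map (teichmuller P : Ap P →* Ap P) ^ s.2.val * oneUnitPow P s.1

/-- `ρ : G_S → G_∞` is the restriction `σ ↦ σ|_{F(Φ[𝔭^∞])}`. -/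
def IsRestriction (P : 𝔽[X]) (ρ : GS P →* GInf P) : Prop :=
  ∀ (σ : GS P) (x : maxAbelian P) (y : cyclotomicField P), (x : FBar 𝔽) = y →
    ((σ x : maxAbelian P) : FBar 𝔽) = (ρ σ y : cyclotomicField P)

/-- The restriction homomorphism `G_S → G_∞`. -/
def restriction (P : 𝔽[X]) : GS P →* GInf P := Classical.epsilon (IsRestriction P)

/-- `κ` satisfies `σ(ε) = Φ_{κ(σ)}(ε)` for `σ ∈ G_∞` and `ε ∈ Φ[𝔭^∞]`. On `Φ[𝔭^n]` the operator
`Φ_{κ(σ)}` is `Φ_b` for any `b ∈ A` congruent to `κ(σ)` modulo `𝔭^n`. -/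
def IsCyclotomicCharacter (P : 𝔽[X]) (κ : GInf P →* (Ap P)ˣ) : Prop :=
  ∀ (σ : GInf P) (n : ℕ) (ε : cyclotomicField P), (ε : FBar 𝔽) ∈ carlitzTorsion (primeIdeal P ^ n) →
    ∀ b : 𝔽[X], Ideal.Quotient.mk (primeIdeal P ^ n) b = red P n (κ σ : Ap P) →
      ((σ ε : cyclotomicField P) : FBar 𝔽) = carlitz 𝔽 b ε

/-- The `𝔭`-cyclotomic character `κ : G_∞ → A_𝔭ˣ`. -/
def cyclotomicChar (P : 𝔽[X]) : GInf P →* (Ap P)ˣ := Classical.epsilon (IsCyclotomicCharacter P)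

/-- The character `ξ_s : G_S → A_𝔭ˣ`, `ξ_s(σ) = κ(σ|_{F(Φ[𝔭^∞])}) ^ s`. -/
def xi (s : Exponent P p) : GS P →* (Ap P)ˣ :=
  (quasiChar P s).comp ((cyclotomicChar P).comp (restriction P))

/-- A character `α : G_S → Rˣ` extended by linearity to `ℤ[G_S] → R` and then, coefficientwise, to
`ℤ[G_S][[X]] → R[[X]]`. -/
def specialize {R : Type*} [CommRing R] (α : GS P →* Rˣ) :
    PowerSeries (MonoidAlgebra ℤ (GS P)) →+* PowerSeries R :=
  PowerSeries.map
    ((MonoidAlgebra.lift ℤ R (GS P) ((Units.coeHom R).comp α) :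
      MonoidAlgebra ℤ (GS P) →ₐ[ℤ] R) : MonoidAlgebra ℤ (GS P) →+* R)

end Characters

section LFunction

variable {𝔽 : Type*} [Field 𝔽] (P : 𝔽[X]) [hP : IsMonicPrime P]

/-- An element of `A - 𝔭` is a unit in `A_𝔭`. -/
theorem isUnit_algebraMap {a : 𝔽[X]} (ha : ¬ P ∣ a) : IsUnit (algebraMap 𝔽[X] (Ap P) a) := by
  have hco : IsCoprime P a := (hP.irreducible.coprime_iff_not_dvd).2 ha
  obtain ⟨u, v, huv⟩ := hco
  have hfg : (primeIdeal P).FG := ⟨{P}, by simp⟩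
  have hcomp : IsAdicComplete ((primeIdeal P).map (algebraMap 𝔽[X] (Ap P))) (Ap P) :=
    AdicCompletion.isAdicComplete_self _ hfg
  have hmem : algebraMap 𝔽[X] (Ap P) P ∈ (⊥ : Ideal (Ap P)).jacobson :=
    IsAdicComplete.le_jacobson_bot _
      (Ideal.mem_map_of_mem _ (Ideal.mem_span_singleton_self P))
  have h1 := Ideal.mem_jacobson_bot.1 hmem (algebraMap 𝔽[X] (Ap P) (-u))
  rw [← map_mul, ← map_one (algebraMap 𝔽[X] (Ap P)), ← map_add,
    show P * -u + 1 = a * v by linear_combination -huv, map_mul] at h1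
  exact isUnit_of_mul_isUnit_left h1

/-- `a ∈ A - 𝔭` as an element of `A_𝔭ˣ`. -/
def toUnit (a : 𝔽[X]) (ha : ¬ P ∣ a) : (Ap P)ˣ := (isUnit_algebraMap P ha).unit

variable [Fintype 𝔽] {p : ℕ} [Fact p.Prime] [CharP 𝔽 p]

open Classical in
/-- The `𝔭`-adic `L`-function
`L_𝔭(X, y, ω_𝔭^i) = ∑_n (∑_{a ∈ A_{+,n} - 𝔭} ω_𝔭(a) ^ i ⟨a⟩_𝔭 ^ y) X ^ n` in `A_𝔭[[X]]`. -/
def padicL (y : ℤ_[p]) (i : ZMod (Fintype.card 𝔽 ^ P.natDegree - 1)) : PowerSeries (Ap P) :=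
  PowerSeries.mk fun n => ∑ a ∈ monicsOfDegree 𝔽 n,
    if ha : P ∣ a then 0 else
      teichmuller P (toUnit P a ha : Ap P) ^ i.val * (oneUnitPow P y (toUnit P a ha) : Ap P)

/-- `S_n(j) = ∑_{a ∈ A_{+,n}} a ^ j`. -/
def powerSum (𝔽 : Type*) [Field 𝔽] [Fintype 𝔽] (n j : ℕ) : 𝔽[X] := ∑ a ∈ monicsOfDegree 𝔽 n, a ^ j

/-- `Z(X, j) = ∑_n S_n(j) X ^ n`, as a power series over `A`. -/
def gossZ (𝔽 : Type*) [Field 𝔽] [Fintype 𝔽] (j : ℕ) : PowerSeries 𝔽[X] :=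
  PowerSeries.mk fun n => powerSum 𝔽 n j

/-- Congruence modulo `𝔭 A_𝔭[[X]]`, i.e. coefficientwise modulo `𝔭 A_𝔭`. -/
def CongrMod (f g : PowerSeries (Ap P)) : Prop :=
  ∀ n, PowerSeries.coeff n f - PowerSeries.coeff n g ∈
    (primeIdeal P).map (algebraMap 𝔽[X] (Ap P))

end LFunction

end

end PadicGoss

open PadicGoss

open scoped Polynomial

/-! Part 1 is a comparison of Euler products. Put f(a) = a^s for a prime to 𝔭 and f(a) = 0 on 𝔭
(`extendChar`). Then f is multiplicative and L_𝔭 is the sum of f(a) X^(deg a) over monic a.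
Multiplying by 1 - f(Q) X^(deg Q) sieves out the multiples of Q (`one_sub_mul_sieveSeries`); once
all primes of degree at most n are sieved out, only a = 1 is left up to degree n
(`coeff_mul_sieveSeries`). So L_𝔭 is the Euler product of f, whose factor at P is trivial, and the
claim reduces to ξ_{-s}(Fr_Q⁻¹) = Q^s for Q ≠ P, that is, to κ(Fr_Q) = Q
(`cyclotomicChar_restriction_frob`).

That reciprocity law comes from the congruence Φ_Q(Y) ≡ Y^(q^deg Q) mod Q (`carlitzPoly_congr`): on
a 𝔭-power torsion point both Fr_Q and Φ_Q agree with this power modulo a prime above Q, and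
reduction there is injective on such points (`frob_eq_carlitz`). Frobenius, restriction and κ are
picked by a choice operator, so existence must be shown for each. In particular F(Φ[𝔭^∞]) has to lie
in the maximal abelian extension unramified outside S; this uses that Φ_a has constant derivative a.

Part 2: for s = (j, j) the character is a ↦ a^j, and sieving Z(X, j) by P alone gives the factor 1 -
P^j X^d. Z(X, j) is a polynomial because power sums over an affine 𝔽-space of dimension n vanish
when j < n (`sum_eval_add_eq_zero`).

Part 3: modulo 𝔭 the one-unit factor is 1 and ω_𝔭(a) is a, so a^s becomes a^i. -/

namespace PadicGoss

noncomputable section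

/-! ### The Carlitz action and its additive polynomials -/

section CarlitzModule

variable (𝔽 : Type*) [Field 𝔽] [Fintype 𝔽]

/-- The Carlitz module on an arbitrary commutative `𝔽[θ]`-algebra. -/
def carlitzEnd (R : Type*) [CommRing R] [Algebra 𝔽 R] [Algebra 𝔽[X] R] :
    𝔽[X] →ₐ[𝔽] Module.End 𝔽 R :=
  Polynomial.aeval (LinearMap.mulLeft 𝔽 (algebraMap 𝔽[X] R Polynomial.X) +
    (FiniteField.frobeniusAlgHom 𝔽 R).toLinearMap)

theorem carlitz_eq_carlitzEnd : carlitz 𝔽 = carlitzEnd 𝔽 (FBar 𝔽) := rfl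

variable {R S : Type*} [CommRing R] [Algebra 𝔽 R] [Algebra 𝔽[X] R]
  [CommRing S] [Algebra 𝔽 S] [Algebra 𝔽[X] S]

theorem carlitzEnd_X (x : R) : carlitzEnd 𝔽 R Polynomial.X x =
    algebraMap 𝔽[X] R Polynomial.X * x + x ^ Fintype.card 𝔽 := by
  simp [carlitzEnd]

theorem carlitzEnd_C (c : 𝔽) (x : R) : carlitzEnd 𝔽 R (Polynomial.C c) x = c • x := by
  simp [carlitzEnd]

theorem carlitzEnd_mul (a b : 𝔽[X]) (x : R) :
    carlitzEnd 𝔽 R (a * b) x = carlitzEnd 𝔽 R a (carlitzEnd 𝔽 R b x) := by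
  rw [map_mul, Module.End.mul_apply]

theorem carlitzEnd_add (a b : 𝔽[X]) (x : R) :
    carlitzEnd 𝔽 R (a + b) x = carlitzEnd 𝔽 R a x + carlitzEnd 𝔽 R b x := by
  rw [map_add, LinearMap.add_apply]

/-- The Carlitz action is natural in the algebra. -/
theorem map_carlitzEnd [IsScalarTower 𝔽 𝔽[X] R] [IsScalarTower 𝔽 𝔽[X] S]
    (φ : R →ₐ[𝔽[X]] S) (a : 𝔽[X]) (x : R) :
    φ (carlitzEnd 𝔽 R a x) = carlitzEnd 𝔽 S a (φ x) := by
  induction a using Polynomial.induction_on generalizing x with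
  | C c =>
    rw [carlitzEnd_C, carlitzEnd_C]
    exact map_smul (φ.restrictScalars 𝔽) c x
  | add a b ha hb => rw [carlitzEnd_add, carlitzEnd_add, map_add, ha, hb]
  | monomial n c h =>
    rw [pow_succ, ← mul_assoc, carlitzEnd_mul, h, carlitzEnd_mul _ (_ * _), carlitzEnd_X,
      carlitzEnd_X]
    simp

variable {𝔽} in
/-- The additive polynomial `Φ_a` with coefficients in `𝔽[θ]`. -/
def carlitzPoly (a : 𝔽[X]) : 𝔽[X][X] := carlitzEnd 𝔽 𝔽[X][X] a Polynomial.X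

theorem aeval_carlitzPoly [IsScalarTower 𝔽 𝔽[X] R] (a : 𝔽[X]) (x : R) :
    Polynomial.aeval x (carlitzPoly a) = carlitzEnd 𝔽 R a x := by
  rw [carlitzPoly, map_carlitzEnd, Polynomial.aeval_X]

variable {𝔽}

theorem carlitzPoly_X_mul_add_C (a : 𝔽[X]) (c : 𝔽) :
    carlitzPoly (Polynomial.X * a + Polynomial.C c) =
      Polynomial.C Polynomial.X * carlitzPoly a + carlitzPoly a ^ Fintype.card 𝔽 +
        Polynomial.C (Polynomial.C c) * Polynomial.X := by
  rw [carlitzPoly, carlitzEnd_add, carlitzEnd_mul, carlitzEnd_X, carlitzEnd_C]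
  congr 1
  rw [Algebra.smul_def]
  rfl

theorem natCast_card_eq_zero (R : Type*) [CommRing R] [Algebra 𝔽 R] :
    ((Fintype.card 𝔽 : ℕ) : R) = 0 := by
  rw [← map_natCast (algebraMap 𝔽 R), FiniteField.cast_card_eq_zero, map_zero]

/-- Each application of Φ_θ adds a q-th power, whose derivative vanishes in characteristic p, so
only the linear coefficient survives. A constant derivative gives both separability over F and
unramifiedness away from a. -/
theorem derivative_carlitzPoly (a : 𝔽[X]) :
    Polynomial.derivative (carlitzPoly a) = Polynomial.C a := by
  have h0 : ((Fintype.card 𝔽 : ℕ) : 𝔽[X]) = 0 := natCast_card_eq_zero _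
  induction h : a.natDegree generalizing a with
  | zero =>
    obtain ⟨c, rfl⟩ := Polynomial.natDegree_eq_zero.1 h
    rw [carlitzPoly, carlitzEnd_C, Algebra.smul_def]
    exact (Polynomial.derivative_C_mul _ _).trans (by simp)
  | succ n ih =>
    have := ih a.divX (by rw [Polynomial.natDegree_divX_eq_natDegree_tsub_one, h]; rfl)
    rw [← a.X_mul_divX_add, carlitzPoly_X_mul_add_C, map_add (Polynomial.C : 𝔽[X] →+* _),
      map_mul (Polynomial.C : 𝔽[X] →+* _)]
    simp only [Polynomial.derivative_add, Polynomial.derivative_C_mul, Polynomial.derivative_pow,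
      this, h0, map_zero, zero_mul, Polynomial.derivative_X, add_zero, mul_one]

theorem carlitzPoly_monic {a : 𝔽[X]} (ha : a.Monic) :
    (carlitzPoly a).Monic ∧ (carlitzPoly a).natDegree = Fintype.card 𝔽 ^ a.natDegree := by
  induction h : a.natDegree generalizing a with
  | zero =>
    obtain rfl := ha.natDegree_eq_zero.1 h
    have : carlitzPoly (1 : 𝔽[X]) = Polynomial.X := by simp [carlitzPoly]
    simp [this, Polynomial.monic_X]
  | succ n ih =>
    have hd : a.divX.natDegree = n := by
      rw [Polynomial.natDegree_divX_eq_natDegree_tsub_one, h]; rfl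
    have hm : a.divX.Monic := by
      rw [Polynomial.Monic, Polynomial.leadingCoeff, hd, Polynomial.coeff_divX, ← h]
      exact ha
    obtain ⟨h1, h2⟩ := ih hm hd
    have hq : 1 < Fintype.card 𝔽 := Fintype.one_lt_card
    have h3 : (carlitzPoly a.divX ^ Fintype.card 𝔽).natDegree = Fintype.card 𝔽 ^ (n + 1) := by
      rw [h1.natDegree_pow, h2, pow_succ']
    have h4 : 1 ≤ Fintype.card 𝔽 ^ n := Nat.one_le_pow _ _ (by omega)
    have h5 : Fintype.card 𝔽 ^ n < Fintype.card 𝔽 ^ (n + 1) := Nat.pow_lt_pow_right hq (by omega)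
    rw [← a.divX_mul_X_add, mul_comm, carlitzPoly_X_mul_add_C, add_right_comm]
    have h6 : (Polynomial.C Polynomial.X * carlitzPoly a.divX +
        Polynomial.C (Polynomial.C (a.coeff 0)) * Polynomial.X).degree <
        (carlitzPoly a.divX ^ Fintype.card 𝔽).degree := by
      refine Polynomial.degree_lt_degree ?_
      rw [h3]
      refine (Polynomial.natDegree_add_le_of_degree_le (n := Fintype.card 𝔽 ^ n) ?_ ?_).trans_lt h5
      · exact (Polynomial.natDegree_C_mul_le _ _).trans h2.le
      · exact (Polynomial.natDegree_C_mul_le _ _).trans (Polynomial.natDegree_X_le.trans h4)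
    refine ⟨(h1.pow _).add_of_right h6, ?_⟩
    rw [Polynomial.natDegree_add_eq_right_of_degree_lt h6, h3]

/-- `Φ_a(Y) = aY + Y²g(Y)`. -/
theorem exists_carlitzPoly_eq (a : 𝔽[X]) :
    ∃ g : 𝔽[X][X], carlitzPoly a = Polynomial.X * (Polynomial.C a + Polynomial.X * g) := by
  have h0 : (carlitzPoly a).coeff 0 = 0 := by
    rw [Polynomial.coeff_zero_eq_aeval_zero, aeval_carlitzPoly, map_zero]
  have h1 : (carlitzPoly a).coeff 1 = a := by
    have := congrArg (Polynomial.coeff · 0) (derivative_carlitzPoly a)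
    simpa [Polynomial.coeff_derivative] using this
  refine ⟨(carlitzPoly a).divX.divX, ?_⟩
  conv_lhs => rw [← (carlitzPoly a).X_mul_divX_add, h0, ← (carlitzPoly a).divX.X_mul_divX_add]
  simp [h1, add_comm]

/-- Reduction modulo a prime not dividing `a` is injective on `a`-torsion. -/
theorem eq_zero_of_carlitzEnd_eq_zero [IsDomain R] [IsScalarTower 𝔽 𝔽[X] R] {a : 𝔽[X]} {x : R}
    (I : Ideal R) (ha : algebraMap 𝔽[X] R a ∉ I) (hx : x ∈ I) (h : carlitzEnd 𝔽 R a x = 0) :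
    x = 0 := by
  obtain ⟨g, hg⟩ := exists_carlitzPoly_eq a
  rw [← aeval_carlitzPoly, hg] at h
  simp only [map_mul, map_add, Polynomial.aeval_X, Polynomial.aeval_C, mul_eq_zero] at h
  -- The other factor of Φ_a(x) = x(a + x g(x)) cannot vanish: it would give a = -x g(x) ∈ I.
  refine h.resolve_right fun h => ha ?_
  rw [eq_neg_of_add_eq_zero_left h]
  exact I.neg_mem (I.mul_mem_right _ hx)

end CarlitzModule

/-! ### The congruence Φ_Q(Y) ≡ Y^(q^deg Q) modulo Q -/

section Reduction

variable {𝔽 : Type*} [Field 𝔽] [Fintype 𝔽]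

/-- Over a field in which the irreducible `Q` has the root `t`, the polynomial `Q` is the product of
the `T - t ^ (q ^ i)` for `i < deg Q`. -/
theorem map_eq_prod_of_irreducible {Q : 𝔽[X]} (hQ : Irreducible Q) (hm : Q.Monic)
    {k : Type*} [Field k] [Algebra 𝔽 k] {t : k} (ht : Polynomial.aeval t Q = 0) :
    Q.map (algebraMap 𝔽 k) =
      ∏ i ∈ Finset.range Q.natDegree, (Polynomial.X - Polynomial.C (t ^ Fintype.card 𝔽 ^ i)) := by
  have hinj : Set.InjOn (fun i => t ^ Fintype.card 𝔽 ^ i) (Finset.range Q.natDegree : Set ℕ) := by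
    have key : ∀ i j, i < j → j < Q.natDegree →
        t ^ Fintype.card 𝔽 ^ i ≠ t ^ Fintype.card 𝔽 ^ j := by
      intro i j hij hj h
      obtain ⟨l, rfl⟩ := Nat.exists_eq_add_of_lt hij
      have h1 : t ^ Fintype.card 𝔽 ^ (l + 1) = t := by
        apply (frobPow 𝔽 k i).injective
        rw [frobPow_apply, frobPow_apply, ← pow_mul, ← pow_add, h]
        congr 2
        ring
      -- A repetition among the conjugates puts t in a field of q^(l+1) elements; then deg Q divides
      -- l + 1, although l + 1 < deg Q.
      have h2 : Q ∣ Polynomial.X ^ Nat.card 𝔽 ^ (l + 1) - Polynomial.X := by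
        rw [minpoly.eq_of_irreducible_of_monic hQ ht hm]
        apply minpoly.dvd
        simp [Nat.card_eq_fintype_card, h1]
      have h3 := hQ.natDegree_dvd_of_dvd_X_pow_card_pow_sub_X h2
      have := Nat.le_of_dvd (by omega) h3
      omega
    intro i hi j hj h
    simp only [Finset.coe_range, Set.mem_Iio] at hi hj
    rcases lt_trichotomy i j with hij | hij | hij
    · exact (key i j hij hj h).elim
    · exact hij
    · exact (key j i hij hi h.symm).elim
  have hroot : ∀ i, (Q.map (algebraMap 𝔽 k)).IsRoot (t ^ Fintype.card 𝔽 ^ i) := by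
    intro i
    have h1 := Polynomial.aeval_algHom_apply (FiniteField.frobeniusAlgHom 𝔽 k ^ i) t Q
    rw [ht, map_zero] at h1
    rw [Polynomial.IsRoot, Polynomial.eval_map_algebraMap, ← frobPow_apply (𝔽 := 𝔽)]
    exact h1
  have hdvd : ∏ i ∈ Finset.range Q.natDegree,
      (Polynomial.X - Polynomial.C (t ^ Fintype.card 𝔽 ^ i)) ∣ Q.map (algebraMap 𝔽 k) := by
    refine Finset.prod_dvd_of_coprime (fun i hi j hj hij => ?_)
      fun i _ => Polynomial.dvd_iff_isRoot.2 (hroot i)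
    exact Polynomial.isCoprime_X_sub_C_of_isUnit_sub
      (sub_ne_zero.2 fun h => hij (hinj hi hj h)).isUnit
  refine (Polynomial.eq_of_monic_of_dvd_of_natDegree_le (Polynomial.monic_prod_of_monic _ _
    fun i _ => Polynomial.monic_X_sub_C _) (hm.map _) hdvd ?_)
  rw [Polynomial.natDegree_prod_of_monic _ _ fun i _ => Polynomial.monic_X_sub_C _]
  simp only [Polynomial.natDegree_X_sub_C, Finset.sum_const, Finset.card_range, smul_eq_mul,
    mul_one, Polynomial.natDegree_map, le_refl]

/-- Composition with `θY + Y ^ q` on `k[Y]`, as a `k`-linear operator. -/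
def compTheta (k : Type*) [Field k] [Algebra 𝔽[X] k] : k[X] →ₐ[k] k[X] :=
  Polynomial.aeval (Polynomial.C (algebraMap 𝔽[X] k Polynomial.X) * Polynomial.X +
    Polynomial.X ^ Fintype.card 𝔽)

/-- Φ_θ may be composed on the inner side instead of the outer one, since Φ_b(Φ_θ(Y)) = Φ_{bθ}(Y).
Inner composition is k-linear, unlike Φ_θ itself, so `a` may be factored over k before it is
evaluated at the operator. -/
theorem carlitzEnd_X_eq_aeval_compTheta (k : Type*) [Field k] [Algebra 𝔽 k] [Algebra 𝔽[X] k]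
    [IsScalarTower 𝔽 𝔽[X] k] (a : 𝔽[X]) :
    carlitzEnd 𝔽 k[X] a Polynomial.X =
      Polynomial.aeval (compTheta (𝔽 := 𝔽) k).toLinearMap (a.map (algebraMap 𝔽 k))
        (Polynomial.X : k[X]) := by
  induction a using Polynomial.induction_on with
  | C c => simp [carlitzEnd_C, Algebra.smul_def]
  | add a b ha hb => rw [carlitzEnd_add, ha, hb, Polynomial.map_add, map_add, LinearMap.add_apply]
  | monomial n c h =>
    have h1 : compTheta (𝔽 := 𝔽) k (Polynomial.X : k[X]) =
        carlitzEnd 𝔽 k[X] Polynomial.X Polynomial.X := by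
      rw [carlitzEnd_X, compTheta, Polynomial.aeval_X]
      rfl
    have h2 := map_carlitzEnd (𝔽 := 𝔽) ((compTheta (𝔽 := 𝔽) k).restrictScalars 𝔽[X])
      (Polynomial.C c * Polynomial.X ^ n) (Polynomial.X : k[X])
    rw [AlgHom.restrictScalars_apply, AlgHom.restrictScalars_apply, h1, ← carlitzEnd_mul, h] at h2
    rw [pow_succ, ← mul_assoc, ← h2, mul_comm _ Polynomial.X, Polynomial.map_mul (p := Polynomial.X),
      map_mul _ (Polynomial.map _ Polynomial.X), Module.End.mul_apply, Polynomial.map_X,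
      Polynomial.aeval_X]
    rfl

/-- Substituting θY + Y^q into Y^(q^s) gives θ^(q^s) Y^(q^s) + Y^(q^(s+1)); the factor with root
θ^(q^s) removes exactly the first term. -/
theorem aeval_compTheta_prod (k : Type*) [Field k] [Algebra 𝔽 k] [Algebra 𝔽[X] k] (s : ℕ) :
    Polynomial.aeval (compTheta (𝔽 := 𝔽) k).toLinearMap
      (∏ i ∈ Finset.range s, (Polynomial.X -
        Polynomial.C (algebraMap 𝔽[X] k Polynomial.X ^ Fintype.card 𝔽 ^ i))) (Polynomial.X : k[X]) =
      Polynomial.X ^ Fintype.card 𝔽 ^ s := by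
  induction s with
  | zero => simp
  | succ s ih =>
    rw [Finset.prod_range_succ, mul_comm, map_mul, Module.End.mul_apply, ih]
    have h : compTheta (𝔽 := 𝔽) k Polynomial.X ^ Fintype.card 𝔽 ^ s =
        frobPow 𝔽 k[X] s (Polynomial.C (algebraMap 𝔽[X] k Polynomial.X) * Polynomial.X +
          Polynomial.X ^ Fintype.card 𝔽) := by
      rw [frobPow_apply, compTheta, Polynomial.aeval_X]
    rw [map_sub, Polynomial.aeval_X, Polynomial.aeval_C, LinearMap.sub_apply,
      AlgHom.toLinearMap_apply, map_pow, h, map_add, frobPow_apply, frobPow_apply,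
      Module.algebraMap_end_apply, Algebra.smul_def, mul_pow, ← pow_mul, ← pow_succ',
      ← Polynomial.C_pow]
    exact add_sub_cancel_left _ _

/-- `Φ_Q(Y) ≡ Y ^ (q ^ deg Q)` modulo `Q`. -/
theorem carlitzPoly_congr {Q : 𝔽[X]} (hQ : Irreducible Q) (hm : Q.Monic) :
    Polynomial.C Q ∣ carlitzPoly Q - Polynomial.X ^ Fintype.card 𝔽 ^ Q.natDegree := by
  have : (Ideal.span {Q}).IsMaximal := PrincipalIdealRing.isMaximal_of_irreducible hQ
  let k := 𝔽[X] ⧸ Ideal.span {Q}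
  let _ : Field k := Ideal.Quotient.field _
  have ht : Polynomial.aeval (algebraMap 𝔽[X] k Polynomial.X) Q = 0 := by
    rw [Polynomial.aeval_algebraMap_apply, Polynomial.aeval_X_left_apply]
    exact Ideal.Quotient.eq_zero_iff_mem.2 (Ideal.mem_span_singleton_self Q)
  have h1 := carlitzEnd_X_eq_aeval_compTheta (𝔽 := 𝔽) k Q
  rw [map_eq_prod_of_irreducible hQ hm ht, aeval_compTheta_prod] at h1
  have h2 := map_carlitzEnd (𝔽 := 𝔽) (Polynomial.mapAlgHom (Algebra.ofId 𝔽[X] k)) Q Polynomial.X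
  rw [Polynomial.C_dvd_iff_dvd_coeff]
  intro i
  rw [← Ideal.mem_span_singleton, ← Ideal.Quotient.eq_zero_iff_mem]
  have h3 : Polynomial.map (algebraMap 𝔽[X] k)
      (carlitzPoly Q - Polynomial.X ^ Fintype.card 𝔽 ^ Q.natDegree) = 0 := by
    rw [Polynomial.map_sub, Polynomial.map_pow, Polynomial.map_X, sub_eq_zero, ← h1]
    refine h2.trans ?_
    simp
  have := congrArg (Polynomial.coeff · i) h3
  rw [Polynomial.coeff_map] at this
  exact this

/-- `Φ_Q(x) ≡ x ^ (q ^ deg Q)` modulo every ideal containing `Q`. -/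
theorem carlitzEnd_sub_pow_mem {R : Type*} [CommRing R] [Algebra 𝔽 R] [Algebra 𝔽[X] R]
    [IsScalarTower 𝔽 𝔽[X] R] {Q : 𝔽[X]} (hQ : Irreducible Q) (hm : Q.Monic) (I : Ideal R)
    (hI : algebraMap 𝔽[X] R Q ∈ I) (x : R) :
    carlitzEnd 𝔽 R Q x - x ^ Fintype.card 𝔽 ^ Q.natDegree ∈ I := by
  obtain ⟨g, hg⟩ := carlitzPoly_congr hQ hm
  have := congrArg (Polynomial.aeval x) hg
  rw [map_sub, map_pow, aeval_carlitzPoly, Polynomial.aeval_X, map_mul, Polynomial.aeval_C] at this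
  rw [this]
  exact I.mul_mem_right _ hI

end Reduction

/-! ### Structure of the 𝔭-power torsion -/

section Torsion

variable {𝔽 : Type*} [Field 𝔽] [Fintype 𝔽]

theorem mem_carlitzTorsion_span {a : 𝔽[X]} {x : FBar 𝔽} :
    x ∈ carlitzTorsion (Ideal.span {a}) ↔ carlitz 𝔽 a x = 0 := by
  refine ⟨fun h => h a (Ideal.mem_span_singleton_self a), fun h b hb => ?_⟩
  obtain ⟨c, rfl⟩ := Ideal.mem_span_singleton.1 hb
  rw [mul_comm, map_mul, Module.End.mul_apply, h, map_zero]

theorem mem_carlitzTorsion_pow {P : 𝔽[X]} {n : ℕ} {x : FBar 𝔽} :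
    x ∈ carlitzTorsion (primeIdeal P ^ n) ↔ carlitz 𝔽 (P ^ n) x = 0 := by
  rw [primeIdeal, Ideal.span_singleton_pow, mem_carlitzTorsion_span]

theorem carlitz_mem_torsion {I : Ideal 𝔽[X]} {x : FBar 𝔽} (hx : x ∈ carlitzTorsion I) (a : 𝔽[X]) :
    carlitz 𝔽 a x ∈ carlitzTorsion I := by
  intro b hb
  rw [← Module.End.mul_apply, ← map_mul, mul_comm, map_mul, Module.End.mul_apply, hx b hb, map_zero]

theorem algHom_carlitz (σ : FBar 𝔽 →ₐ[RatField 𝔽] FBar 𝔽) (a : 𝔽[X]) (x : FBar 𝔽) :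
    σ (carlitz 𝔽 a x) = carlitz 𝔽 a (σ x) :=
  map_carlitzEnd 𝔽 (σ.restrictScalars 𝔽[X]) a x

instance isScalarTower_intermediateField (E : IntermediateField (RatField 𝔽) (FBar 𝔽)) :
    IsScalarTower 𝔽 𝔽[X] E :=
  IsScalarTower.of_algebraMap_eq fun c =>
    Subtype.ext (IsScalarTower.algebraMap_apply 𝔽 𝔽[X] (FBar 𝔽) c)

/-- An intermediate field is stable under the Carlitz action. -/
theorem carlitz_mem_intermediateField (E : IntermediateField (RatField 𝔽) (FBar 𝔽)) (a : 𝔽[X])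
    {x : FBar 𝔽} (hx : x ∈ E) : carlitz 𝔽 a x ∈ E := by
  have := map_carlitzEnd 𝔽 (E.val.restrictScalars 𝔽[X]) a ⟨x, hx⟩
  rw [carlitz_eq_carlitzEnd]
  exact this ▸ Subtype.coe_prop _

/-- `Φ_a` as a polynomial over `F`. -/
def carlitzPolyRat (a : 𝔽[X]) : (RatField 𝔽)[X] :=
  (carlitzPoly a).map (algebraMap 𝔽[X] (RatField 𝔽))

theorem aeval_carlitzPolyRat (a : 𝔽[X]) (x : FBar 𝔽) :
    Polynomial.aeval x (carlitzPolyRat a) = carlitz 𝔽 a x := by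
  rw [carlitzPolyRat, Polynomial.aeval_map_algebraMap, aeval_carlitzPoly]
  rfl

theorem carlitzPolyRat_separable {a : 𝔽[X]} (ha : a ≠ 0) : (carlitzPolyRat a).Separable := by
  rw [Polynomial.Separable, carlitzPolyRat, Polynomial.derivative_map, derivative_carlitzPoly,
    Polynomial.map_C]
  refine isCoprime_one_right.of_isCoprime_of_dvd_right (Polynomial.isUnit_C.2 ?_).dvd
  exact ((map_ne_zero_iff _ (RatFunc.algebraMap_injective 𝔽)).2 ha).isUnit

theorem rootSet_carlitzPolyRat {a : 𝔽[X]} (ha : a ≠ 0) :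
    (carlitzPolyRat a).rootSet (FBar 𝔽) = carlitzTorsion (Ideal.span {a}) := by
  ext x
  rw [Polynomial.mem_rootSet_of_ne (carlitzPolyRat_separable ha).ne_zero, aeval_carlitzPolyRat,
    mem_carlitzTorsion_span]

theorem natCard_carlitzTorsion {a : 𝔽[X]} (ha : a.Monic) :
    Nat.card (carlitzTorsion (Ideal.span {a})) = Fintype.card 𝔽 ^ a.natDegree := by
  rw [← rootSet_carlitzPolyRat ha.ne_zero, Nat.card_eq_fintype_card,
    Polynomial.card_rootSet_eq_natDegree (carlitzPolyRat_separable ha.ne_zero)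
      (IsAlgClosed.splits _), carlitzPolyRat, (carlitzPoly_monic ha).1.natDegree_map,
    (carlitzPoly_monic ha).2]

variable (P : 𝔽[X]) [hP : IsMonicPrime P]

theorem natCard_carlitzTorsion_pow (n : ℕ) :
    Nat.card (carlitzTorsion (primeIdeal P ^ n)) = Fintype.card 𝔽 ^ (n * P.natDegree) := by
  rw [primeIdeal, Ideal.span_singleton_pow, natCard_carlitzTorsion (hP.monic.pow n),
    hP.monic.natDegree_pow]

theorem natCard_quotient_pow (n : ℕ) :
    Nat.card (𝔽[X] ⧸ primeIdeal P ^ n) = Fintype.card 𝔽 ^ (n * P.natDegree) := by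
  rw [primeIdeal, Ideal.span_singleton_pow]
  have : Module.Finite 𝔽 (𝔽[X] ⧸ Ideal.span {P ^ n}) := (hP.monic.pow n).finite_quotient
  rw [Module.natCard_eq_pow_finrank (K := 𝔽), finrank_quotient_span_eq_natDegree,
    Nat.card_eq_fintype_card, hP.monic.natDegree_pow]

/-- There is a torsion point with annihilator exactly `𝔭 ^ n`. -/
theorem exists_annihilator_eq (n : ℕ) :
    ∃ x : FBar 𝔽, ∀ a : 𝔽[X], carlitz 𝔽 a x = 0 ↔ P ^ n ∣ a := by
  classical
  rcases n with _ | n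
  · exact ⟨0, by simp⟩
  -- Counting: the two torsion sets have q^((n+1)d) and q^(nd) elements. Any point in the difference
  -- will do.
  have hne : ¬ carlitzTorsion (primeIdeal P ^ (n + 1)) ⊆ carlitzTorsion (primeIdeal P ^ n) := by
    intro h
    have hfin : (carlitzTorsion (primeIdeal P ^ n)).Finite := by
      refine Nat.finite_of_card_ne_zero ?_
      rw [natCard_carlitzTorsion_pow]
      exact pow_ne_zero _ Fintype.card_ne_zero
    have h1 := Nat.card_mono hfin h
    rw [natCard_carlitzTorsion_pow, natCard_carlitzTorsion_pow] at h1
    have h2 := (Nat.pow_le_pow_iff_right (Fintype.one_lt_card (α := 𝔽))).1 h1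
    have := hP.irreducible.natDegree_pos
    rw [add_mul] at h2
    omega
  obtain ⟨x, hx, hx'⟩ := Set.not_subset.1 hne
  rw [mem_carlitzTorsion_pow] at hx hx'
  refine ⟨x, fun a => ⟨fun ha => ?_, ?_⟩⟩
  -- If a kills x without being divisible by P^(n+1), the gcd of a and P^(n+1) divides P^n, and
  -- Bézout makes P^n kill x.
  · by_contra hd
    obtain ⟨i, hi, hg⟩ := (dvd_prime_pow hP.irreducible.prime _).1
      (EuclideanDomain.gcd_dvd_right a (P ^ (n + 1)))
    have hin : i ≤ n := by
      by_contra hin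
      obtain rfl : i = n + 1 := by omega
      exact hd (hg.symm.dvd.trans (EuclideanDomain.gcd_dvd_left _ _))
    obtain ⟨c, hc⟩ := hg.dvd.trans (pow_dvd_pow P hin)
    apply hx'
    rw [hc, EuclideanDomain.gcd_eq_gcd_ab, add_mul, map_add, LinearMap.add_apply,
      mul_assoc, mul_assoc, mul_comm a, mul_comm (P ^ (n + 1)), map_mul, map_mul _ _ (P ^ (n + 1)),
      Module.End.mul_apply, Module.End.mul_apply, ha, hx, map_zero, map_zero, add_zero]
  · rintro ⟨c, rfl⟩
    rw [mul_comm, map_mul, Module.End.mul_apply, hx, map_zero]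

/-- A generator of the `A`-module `Φ[𝔭 ^ n]`. -/
def torsionGenerator (n : ℕ) : FBar 𝔽 := (exists_annihilator_eq P n).choose

theorem carlitz_torsionGenerator_eq_zero {n : ℕ} {a : 𝔽[X]} :
    carlitz 𝔽 a (torsionGenerator P n) = 0 ↔ P ^ n ∣ a :=
  (exists_annihilator_eq P n).choose_spec a

theorem torsionGenerator_mem (n : ℕ) :
    torsionGenerator P n ∈ carlitzTorsion (primeIdeal P ^ n) := by
  rw [mem_carlitzTorsion_pow, carlitz_torsionGenerator_eq_zero]

theorem mk_eq_of_carlitz_torsionGenerator {n : ℕ} {a b : 𝔽[X]}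
    (h : carlitz 𝔽 a (torsionGenerator P n) = carlitz 𝔽 b (torsionGenerator P n)) :
    Ideal.Quotient.mk (primeIdeal P ^ n) a = Ideal.Quotient.mk (primeIdeal P ^ n) b := by
  rw [Ideal.Quotient.eq, primeIdeal, Ideal.span_singleton_pow, Ideal.mem_span_singleton,
    ← carlitz_torsionGenerator_eq_zero, map_sub, LinearMap.sub_apply, h, sub_self]

theorem carlitz_eq_of_mk_eq {I : Ideal 𝔽[X]} {a b : 𝔽[X]}
    (h : Ideal.Quotient.mk I a = Ideal.Quotient.mk I b) {x : FBar 𝔽} (hx : x ∈ carlitzTorsion I) :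
    carlitz 𝔽 a x = carlitz 𝔽 b x := by
  have := hx _ (Ideal.Quotient.eq.1 h)
  rwa [map_sub, LinearMap.sub_apply, sub_eq_zero] at this

/-- Acting on the generator embeds A/𝔭^n into Φ[𝔭^n], and both have q^(nd) elements. -/
theorem exists_carlitz_torsionGenerator {n : ℕ} {x : FBar 𝔽}
    (hx : x ∈ carlitzTorsion (primeIdeal P ^ n)) :
    ∃ a : 𝔽[X], x = carlitz 𝔽 a (torsionGenerator P n) := by
  let f : 𝔽[X] ⧸ primeIdeal P ^ n → carlitzTorsion (primeIdeal P ^ n) := fun y =>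
    ⟨carlitz 𝔽 y.out (torsionGenerator P n), carlitz_mem_torsion (torsionGenerator_mem P n) _⟩
  have hf : Function.Injective f := by
    intro y z h
    have := mk_eq_of_carlitz_torsionGenerator P (congrArg Subtype.val h)
    rwa [Ideal.Quotient.mk_out, Ideal.Quotient.mk_out] at this
  have : Finite (carlitzTorsion (primeIdeal P ^ n)) := by
    refine Nat.finite_of_card_ne_zero ?_
    rw [natCard_carlitzTorsion_pow]
    exact pow_ne_zero _ Fintype.card_ne_zero
  obtain ⟨y, hy⟩ := ((Nat.bijective_iff_injective_and_card f).2
    ⟨hf, by rw [natCard_carlitzTorsion_pow, natCard_quotient_pow]⟩).2 ⟨x, hx⟩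
  exact ⟨y.out, (congrArg Subtype.val hy).symm⟩

/-- Every automorphism acts on `Φ[𝔭 ^ n]` as some `Φ_b`. -/
theorem exists_algHom_eq_carlitz (σ : FBar 𝔽 →ₐ[RatField 𝔽] FBar 𝔽) (n : ℕ) :
    ∃ b : 𝔽[X], ∀ x ∈ carlitzTorsion (primeIdeal P ^ n), σ x = carlitz 𝔽 b x := by
  have hσ : σ (torsionGenerator P n) ∈ carlitzTorsion (primeIdeal P ^ n) := by
    rw [mem_carlitzTorsion_pow, ← algHom_carlitz,
      mem_carlitzTorsion_pow.1 (torsionGenerator_mem P n), map_zero]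
  obtain ⟨b, hb⟩ := exists_carlitz_torsionGenerator P hσ
  refine ⟨b, fun x hx => ?_⟩
  obtain ⟨a, rfl⟩ := exists_carlitz_torsionGenerator P hx
  rw [algHom_carlitz, hb, ← Module.End.mul_apply, ← map_mul, mul_comm, map_mul,
    Module.End.mul_apply]

end Torsion

/-! ### Existence of the cyclotomic character κ -/

section CyclotomicCharacter

variable {𝔽 : Type*} [Field 𝔽] [Fintype 𝔽] (P : 𝔽[X])

/-- The `n`-th layer `F(Φ[𝔭 ^ n])` of the cyclotomic tower. -/
abbrev cyclotomicLayer (n : ℕ) : IntermediateField (RatField 𝔽) (FBar 𝔽) :=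
  IntermediateField.adjoin (RatField 𝔽) (carlitzTorsion (primeIdeal P ^ n))

theorem mem_cyclotomicField {n : ℕ} {x : FBar 𝔽} (hx : x ∈ carlitzTorsion (primeIdeal P ^ n)) :
    x ∈ cyclotomicField P :=
  le_iSup (cyclotomicLayer P) n (IntermediateField.subset_adjoin _ _ hx)

variable [hP : IsMonicPrime P]

/-- `F(Φ[𝔭 ^ n])` is generated by one torsion point. -/
theorem cyclotomicLayer_eq_adjoin (n : ℕ) :
    cyclotomicLayer P n = IntermediateField.adjoin (RatField 𝔽) {torsionGenerator P n} := by
  refine le_antisymm (IntermediateField.adjoin_le_iff.2 fun x hx => ?_)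
    (IntermediateField.adjoin.mono _ _ _ (Set.singleton_subset_iff.2 (torsionGenerator_mem P n)))
  obtain ⟨a, rfl⟩ := exists_carlitz_torsionGenerator P hx
  exact carlitz_mem_intermediateField _ a (IntermediateField.mem_adjoin_simple_self _ _)

theorem exists_galois_eq_carlitz (E : IntermediateField (RatField 𝔽) (FBar 𝔽))
    (σ : Gal(E/RatField 𝔽)) (n : ℕ) : ∃ b : 𝔽[X], ∀ x : E,
      (x : FBar 𝔽) ∈ carlitzTorsion (primeIdeal P ^ n) → (σ x : FBar 𝔽) = carlitz 𝔽 b x := by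
  obtain ⟨b, hb⟩ := exists_algHom_eq_carlitz P (σ.liftNormal (FBar 𝔽)).toAlgHom n
  refine ⟨b, fun x hx => ?_⟩
  rw [← hb x hx]
  exact (AlgEquiv.liftNormal_commutes σ (FBar 𝔽) x).symm

/-- The residue modulo `𝔭 ^ n` by which `σ` acts on `Φ[𝔭 ^ n]`. -/
def cyclotomicResidue (n : ℕ) (σ : GInf P) : 𝔽[X] :=
  (exists_galois_eq_carlitz P (cyclotomicField P) σ n).choose

theorem galois_eq_carlitz_cyclotomicResidue {n : ℕ} (σ : GInf P) {x : cyclotomicField P}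
    (hx : (x : FBar 𝔽) ∈ carlitzTorsion (primeIdeal P ^ n)) :
    (σ x : FBar 𝔽) = carlitz 𝔽 (cyclotomicResidue P n σ) x :=
  (exists_galois_eq_carlitz P (cyclotomicField P) σ n).choose_spec x hx

/-- The generator of Φ[𝔭^n] detects residues modulo 𝔭^n. This uniqueness makes the chosen residues
multiplicative in σ and compatible in n. -/
theorem mk_eq_mk_cyclotomicResidue {n : ℕ} {σ : GInf P} {b : 𝔽[X]}
    (h : ∀ x : cyclotomicField P, (x : FBar 𝔽) ∈ carlitzTorsion (primeIdeal P ^ n) →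
      (σ x : FBar 𝔽) = carlitz 𝔽 b x) :
    Ideal.Quotient.mk (primeIdeal P ^ n) b =
      Ideal.Quotient.mk (primeIdeal P ^ n) (cyclotomicResidue P n σ) := by
  have hx := torsionGenerator_mem P n
  apply mk_eq_of_carlitz_torsionGenerator
  exact (h ⟨_, mem_cyclotomicField P hx⟩ hx).symm.trans
    (galois_eq_carlitz_cyclotomicResidue P σ (x := ⟨_, mem_cyclotomicField P hx⟩) hx)

/-- The `𝔭`-cyclotomic character modulo `𝔭 ^ n`. -/
def cyclotomicCharMod (n : ℕ) : GInf P →* 𝔽[X] ⧸ primeIdeal P ^ n where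
  toFun σ := Ideal.Quotient.mk _ (cyclotomicResidue P n σ)
  map_one' := by
    rw [← mk_eq_mk_cyclotomicResidue P (b := 1), map_one]
    intro x _
    rw [map_one]
    rfl
  map_mul' σ τ := by
    rw [← map_mul]
    refine (mk_eq_mk_cyclotomicResidue P fun x hx => ?_).symm
    rw [AlgEquiv.mul_apply, map_mul, Module.End.mul_apply,
      ← galois_eq_carlitz_cyclotomicResidue P τ hx]
    apply galois_eq_carlitz_cyclotomicResidue
    rw [galois_eq_carlitz_cyclotomicResidue P τ hx]
    exact carlitz_mem_torsion hx _

theorem exists_isCyclotomicCharacter : ∃ κ : GInf P →* (Ap P)ˣ, IsCyclotomicCharacter P κ := by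
  refine ⟨(liftMonoidHom P (cyclotomicCharMod P) fun {m n} h σ => ?_).toHomUnits, ?_⟩
  · refine mk_eq_mk_cyclotomicResidue P fun x hx => galois_eq_carlitz_cyclotomicResidue P σ ?_
    exact fun a ha => hx a (Ideal.pow_le_pow_right h ha)
  · intro σ n x hx b hb
    have h : Ideal.Quotient.mk (primeIdeal P ^ n) b =
        Ideal.Quotient.mk (primeIdeal P ^ n) (cyclotomicResidue P n σ) :=
      hb.trans (red_liftMonoidHom P _ _ σ n)
    rw [carlitz_eq_of_mk_eq h hx]
    exact galois_eq_carlitz_cyclotomicResidue P σ hx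

theorem isCyclotomicCharacter_cyclotomicChar : IsCyclotomicCharacter P (cyclotomicChar P) :=
  Classical.epsilon_spec (exists_isCyclotomicCharacter P)

end CyclotomicCharacter

/-! ### The cyclotomic tower is abelian and unramified outside 𝔭 and ∞ -/

section Unramified

open Polynomial in
/-- If `L = K(x)` with `x` a root of `f ∈ A[X]`, then a prime not containing `f'(x)` is
unramified. -/
theorem isUnramifiedAt_of_aeval_derivative_notMem {A K L : Type*} [CommRing A] [IsDedekindDomain A]
    [Field K] [Field L] [Algebra A K] [IsFractionRing A K] [Algebra K L] [Algebra A L]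
    [IsScalarTower A K L] [FiniteDimensional K L] [Algebra.IsSeparable K L]
    (x : integralClosure A L) (hx : Algebra.adjoin K {(x : L)} = ⊤) {f : A[X]}
    (hf : aeval x f = 0) (𝔔 : Ideal (integralClosure A L)) [𝔔.IsPrime]
    (h : aeval x (derivative f) ∉ 𝔔) : Algebra.IsUnramifiedAt A 𝔔 := by
  let B := integralClosure A L
  have : IsFractionRing B L := integralClosure.isFractionRing_of_finite_extension K L
  have : IsDedekindDomain B := integralClosure.isDedekindDomain A K L
  have : Module.Finite A B := IsIntegralClosure.finite A K L B
  have hinj : Function.Injective (algebraMap A L) := by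
    rw [IsScalarTower.algebraMap_eq A K L]
    exact (algebraMap K L).injective.comp (IsFractionRing.injective A K)
  have hinj' : Function.Injective (algebraMap A B) :=
    Function.Injective.of_comp (f := algebraMap B L) hinj
  have : FaithfulSMul A B := (faithfulSMul_iff_algebraMap_injective A B).2 hinj'
  have : Module.IsTorsionFree A B := inferInstance
  let _ : Algebra (FractionRing A) (FractionRing B) := FractionRing.liftAlgebra A (FractionRing B)
  have : Algebra.IsSeparable (FractionRing A) (FractionRing B) := by
    refine Algebra.IsSeparable.of_equiv_equiv (FractionRing.algEquiv A K).symm.toRingEquiv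
      (FractionRing.algEquiv B L).symm.toRingEquiv ?_
    ext _
    exact IsFractionRing.algEquiv_commutes (FractionRing.algEquiv A K).symm
      (FractionRing.algEquiv B L).symm _
  rw [← not_dvd_differentIdeal_iff]
  intro hd
  -- Ramification at 𝔔 means that 𝔔 divides the different, which contains m'(x) for the minimal
  -- polynomial m of x. Since A is integrally closed, f = m g over A, so f'(x) = m'(x) g(x) would
  -- lie in 𝔔.
  have hmem := Ideal.dvd_iff_le.1 hd (aeval_derivative_mem_differentIdeal A K L x hx)
  obtain ⟨g, hg⟩ := minpoly.isIntegrallyClosed_dvd (Algebra.IsIntegral.isIntegral (R := A) x) hf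
  apply h
  rw [hg, derivative_mul, map_add, map_mul, map_mul, minpoly.aeval, zero_mul, add_zero]
  exact 𝔔.mul_mem_right _ hmem

/-- Restriction of automorphisms to a normal subextension. -/
theorem exists_restriction_of_le {K L : Type*} [Field K] [Field L] [Algebra K L]
    {E M : IntermediateField K L} (h : E ≤ M) [Normal K E] :
    ∃ ρ : Gal(M/K) →* Gal(E/K), ∀ (σ : Gal(M/K)) (x : M) (y : E), (x : L) = y →
      ((σ x : M) : L) = (ρ σ y : E) := by
  let ι := IntermediateField.inclusion h
  let _ : Algebra E M := ι.toRingHom.toAlgebra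
  have : IsScalarTower K E M := IsScalarTower.of_algebraMap_eq' ι.comp_algebraMap.symm
  refine ⟨AlgEquiv.restrictNormalHom E, fun σ x y hxy => ?_⟩
  obtain rfl : x = algebraMap E M y := Subtype.ext hxy
  exact congrArg Subtype.val (AlgEquiv.restrictNormal_commutes σ E y).symm

variable {𝔽 : Type*} [Field 𝔽]

theorem algebraMap_notMem_of_liesOver {P : 𝔽[X]} (hP : IsMonicPrime P) (Q : Place P) (n : ℕ)
    {B : Type*} [CommRing B] [Algebra 𝔽[X] B] (𝔔 : Ideal B) [h𝔔 : 𝔔.IsPrime]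
    [h : 𝔔.LiesOver (primeIdeal Q.1)] : algebraMap 𝔽[X] B (P ^ n) ∉ 𝔔 := by
  intro hmem
  rw [map_pow] at hmem
  have h1 : P ∈ 𝔔.under 𝔽[X] := h𝔔.mem_of_pow_mem _ hmem
  rw [← h.over, Ideal.mem_span_singleton] at h1
  exact Q.2.2 (Polynomial.eq_of_monic_of_associated Q.2.1.monic hP.monic
    (Q.2.1.irreducible.associated_of_dvd hP.irreducible h1))

variable [Fintype 𝔽] (P : 𝔽[X]) [hP : IsMonicPrime P]

theorem isSplittingField_cyclotomicLayer (n : ℕ) :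
    (carlitzPolyRat (P ^ n)).IsSplittingField (RatField 𝔽) (cyclotomicLayer P n) := by
  have := IntermediateField.adjoin_rootSet_isSplittingField
    (IsAlgClosed.splits ((carlitzPolyRat (P ^ n)).map (algebraMap (RatField 𝔽) (FBar 𝔽))))
  rwa [rootSet_carlitzPolyRat (hP.monic.pow n).ne_zero, ← Ideal.span_singleton_pow] at this

instance isGalois_cyclotomicLayer (n : ℕ) : IsGalois (RatField 𝔽) (cyclotomicLayer P n) :=
  have := isSplittingField_cyclotomicLayer P n
  IsGalois.of_separable_splitting_field (carlitzPolyRat_separable (hP.monic.pow n).ne_zero)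

theorem finiteDimensional_cyclotomicLayer (n : ℕ) :
    FiniteDimensional (RatField 𝔽) (cyclotomicLayer P n) :=
  have := isSplittingField_cyclotomicLayer P n
  Polynomial.IsSplittingField.finiteDimensional _ (carlitzPolyRat (P ^ n))

/-- Two automorphisms act on the generating torsion points as Φ_a and Φ_b, and these commute because
A does. -/
theorem isAbelianGalois_cyclotomicLayer (n : ℕ) :
    IsAbelianGalois (RatField 𝔽) (cyclotomicLayer P n) := by
  refine { isGalois_cyclotomicLayer P n with is_comm := ⟨fun σ τ => ?_⟩ }
  obtain ⟨a, ha⟩ := exists_galois_eq_carlitz P _ σ n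
  obtain ⟨b, hb⟩ := exists_galois_eq_carlitz P _ τ n
  have h : ((cyclotomicLayer P n).val.comp (σ * τ).toAlgHom) =
      ((cyclotomicLayer P n).val.comp (τ * σ).toAlgHom) := by
    refine IntermediateField.algHom_ext_of_eq_adjoin _ rfl fun x hx => ?_
    let z : cyclotomicLayer P n := ⟨x, IntermediateField.subset_adjoin (RatField 𝔽) _ hx⟩
    have h1 : (σ z : FBar 𝔽) = carlitz 𝔽 a x := ha z hx
    have h2 : (τ z : FBar 𝔽) = carlitz 𝔽 b x := hb z hx
    change (σ (τ z) : FBar 𝔽) = (τ (σ z) : FBar 𝔽)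
    rw [ha (τ z) (h2.symm ▸ carlitz_mem_torsion hx b), hb (σ z) (h1.symm ▸ carlitz_mem_torsion hx a),
      h1, h2, ← Module.End.mul_apply, ← Module.End.mul_apply, ← map_mul, ← map_mul, mul_comm]
  exact AlgEquiv.ext fun x => Subtype.ext (DFunLike.congr_fun h x)

theorem isIntegral_of_mem_carlitzTorsion {n : ℕ} {x : FBar 𝔽}
    (hx : x ∈ carlitzTorsion (primeIdeal P ^ n)) : IsIntegral 𝔽[X] x := by
  refine ⟨carlitzPoly (P ^ n), (carlitzPoly_monic (hP.monic.pow n)).1, ?_⟩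
  rw [← Polynomial.aeval_def, aeval_carlitzPoly]
  exact mem_carlitzTorsion_pow.1 hx

/-- The layer is generated by a root of Φ_{P^n}, whose derivative is the constant P^n; no prime
above Q ≠ P contains it. -/
theorem unramifiedOutside_cyclotomicLayer (n : ℕ) :
    UnramifiedOutside P (cyclotomicLayer P n) := by
  intro Q 𝔔 _ hlies
  have := finiteDimensional_cyclotomicLayer P n
  have hmem : torsionGenerator P n ∈ cyclotomicLayer P n :=
    IntermediateField.subset_adjoin _ _ (torsionGenerator_mem P n)
  let y : cyclotomicLayer P n := ⟨_, hmem⟩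
  have hy : IsIntegral 𝔽[X] y :=
    (isIntegral_algHom_iff ((cyclotomicLayer P n).val.restrictScalars 𝔽[X])
      (cyclotomicLayer P n).val.injective).1
      (isIntegral_of_mem_carlitzTorsion P (torsionGenerator_mem P n))
  let x : integralClosure 𝔽[X] (cyclotomicLayer P n) := ⟨y, hy⟩
  have hgen : Algebra.adjoin (RatField 𝔽) {(x : cyclotomicLayer P n)} = ⊤ := by
    have halg : IsAlgebraic (RatField 𝔽) (torsionGenerator P n) :=
      Algebra.IsAlgebraic.isAlgebraic _
    refine Subalgebra.map_injective (f := (cyclotomicLayer P n).val)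
      (cyclotomicLayer P n).val.injective ?_
    rw [AlgHom.map_adjoin, Set.image_singleton, Algebra.map_top, IntermediateField.range_val]
    refine (IntermediateField.adjoin_simple_toSubalgebra_of_isAlgebraic halg).symm.trans ?_
    rw [← cyclotomicLayer_eq_adjoin]
  refine isUnramifiedAt_of_aeval_derivative_notMem (K := RatField 𝔽) x hgen
    (f := carlitzPoly (P ^ n)) ?_ 𝔔 ?_
  · have hinj : Function.Injective (((cyclotomicLayer P n).val.restrictScalars 𝔽[X]).comp
        (integralClosure 𝔽[X] (cyclotomicLayer P n)).val) :=
      (cyclotomicLayer P n).val.injective.comp Subtype.val_injective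
    apply hinj
    rw [← Polynomial.aeval_algHom_apply, map_zero, aeval_carlitzPoly]
    exact mem_carlitzTorsion_pow.1 (torsionGenerator_mem P n)
  · rw [derivative_carlitzPoly, Polynomial.aeval_C]
    exact algebraMap_notMem_of_liesOver hP Q n 𝔔

theorem cyclotomicField_le_maxAbelian : cyclotomicField P ≤ maxAbelian P :=
  iSup_le fun n => le_sSup ⟨finiteDimensional_cyclotomicLayer P n,
    isAbelianGalois_cyclotomicLayer P n, unramifiedOutside_cyclotomicLayer P n⟩

instance normal_cyclotomicField : Normal (RatField 𝔽) (cyclotomicField P) :=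
  IntermediateField.normal_iSup (h := fun n => (isGalois_cyclotomicLayer P n).to_normal)

theorem exists_isRestriction : ∃ ρ : GS P →* GInf P, IsRestriction P ρ := by
  obtain ⟨ρ, hρ⟩ := exists_restriction_of_le (cyclotomicField_le_maxAbelian P)
  exact ⟨ρ, hρ⟩

theorem isRestriction_restriction : IsRestriction P (restriction P) :=
  Classical.epsilon_spec (exists_isRestriction P)

end Unramified

/-! ### Frobenius elements and the law κ(Fr_Q) = Q -/

section Frobenius

section General

variable (A : Type*) {K L : Type*} [CommRing A] [Field K] [Field L] [Algebra A K]
  [IsFractionRing A K] [Algebra K L] [Algebra A L] [IsScalarTower A K L]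

theorem isInvariant_integralClosure [IsDomain A] [IsIntegrallyClosed A] [IsGalois K L] :
    Algebra.IsInvariant A (integralClosure A L) Gal(L/K) where
  isInvariant b hb := by
    have hb' : ∀ σ : Gal(L/K), σ (b : L) = b := fun σ => congrArg Subtype.val (hb σ)
    obtain ⟨x, hx⟩ := (InfiniteGalois.mem_bot_iff_fixed (k := K) (b : L)).2 hb'
    have hxi : IsIntegral A x := by
      rw [← isIntegral_algebraMap_iff (algebraMap K L).injective]
      exact hx.symm ▸ b.2
    obtain ⟨a, rfl⟩ := IsIntegrallyClosed.isIntegral_iff.1 hxi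
    refine ⟨a, Subtype.ext ?_⟩
    rw [← hx]
    exact IsScalarTower.algebraMap_apply A K L a

/-- In a (possibly infinite) Galois extension, every prime with finite residue field below has a
Frobenius automorphism. -/
theorem exists_isArithFrobAt [IsDomain A] [IsIntegrallyClosed A] [IsGalois K L]
    (𝔔 : Ideal (integralClosure A L)) [𝔔.IsPrime] [Finite (A ⧸ 𝔔.under A)] :
    ∃ σ : Gal(L/K), IsArithFrobAt A σ 𝔔 := by
  let B := integralClosure A L
  let 𝔮 := 𝔔.under A
  have := isInvariant_integralClosure A (K := K) (L := L)
  let _ : TopologicalSpace B := ⊥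
  have : DiscreteTopology B := ⟨rfl⟩
  -- For discrete B continuity says that stabilizers are open, which holds because every element of
  -- B is integral. This gives access to the profinite form of decomposition theory for infinite
  -- L/K.
  have : ContinuousSMul Gal(L/K) B := by
    rw [continuousSMul_iff_stabilizer_isOpen]
    intro b
    convert stabilizer_isOpen_of_isIntegral (K := K) (b : L) using 2
    ext σ
    exact Subtype.ext_iff
  have : 𝔮.IsMaximal := Ideal.Quotient.maximal_of_isField _ (Finite.isField_of_domain (A ⧸ 𝔮))
  have : 𝔔.IsMaximal := Ideal.isMaximal_of_isIntegral_of_isMaximal_comap 𝔔 this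
  let _ : Field (A ⧸ 𝔮) := Ideal.Quotient.field _
  let _ : Field (B ⧸ 𝔔) := Ideal.Quotient.field _
  have : Fintype (A ⧸ 𝔮) := Fintype.ofFinite _
  have : Algebra.IsIntegral (A ⧸ 𝔮) (B ⧸ 𝔔) := inferInstance
  have : Algebra.IsAlgebraic (A ⧸ 𝔮) (B ⧸ 𝔔) := Algebra.IsIntegral.isAlgebraic
  -- The decomposition group surjects onto the automorphisms of the residue extension; lift the
  -- Frobenius of the finite field A/𝔮.
  obtain ⟨σ, hσ⟩ := Ideal.Quotient.stabilizerHom_surjective_of_profinite (G := Gal(L/K)) 𝔮 𝔔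
    (FiniteField.frobeniusAlgEquivOfAlgebraic (A ⧸ 𝔮) (B ⧸ 𝔔))
  refine ⟨σ, fun x => ?_⟩
  rw [← Ideal.Quotient.eq, Nat.card_eq_fintype_card]
  exact DFunLike.congr_fun hσ (Ideal.Quotient.mk 𝔔 x)

/-- In an abelian extension, a Frobenius at one prime is a Frobenius at all conjugate primes. -/
theorem isArithFrobAt_of_under_eq [IsDomain A] [IsIntegrallyClosed A] [IsGalois K L]
    (hcomm : ∀ σ τ : Gal(L/K), σ * τ = τ * σ) {𝔔 𝔔' : Ideal (integralClosure A L)} [𝔔.IsPrime]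
    [𝔔'.IsPrime] (h : 𝔔.under A = 𝔔'.under A) {σ : Gal(L/K)} (hσ : IsArithFrobAt A σ 𝔔) :
    IsArithFrobAt A σ 𝔔' := by
  let B := integralClosure A L
  have := isInvariant_integralClosure A (K := K) (L := L)
  let _ : TopologicalSpace B := ⊥
  have : DiscreteTopology B := ⟨rfl⟩
  have : ContinuousSMul Gal(L/K) B := by
    rw [continuousSMul_iff_stabilizer_isOpen]
    intro b
    convert stabilizer_isOpen_of_isIntegral (K := K) (b : L) using 2
    ext σ
    exact Subtype.ext_iff
  -- Primes with the same contraction are conjugate by some τ. The Frobenius at the conjugate prime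
  -- is τστ⁻¹, which is σ by commutativity.
  obtain ⟨τ, rfl⟩ := Algebra.IsInvariant.exists_smul_of_under_eq_of_profinite (A := A)
    (G := Gal(L/K)) 𝔔 𝔔' h
  have := hσ.conj τ
  rwa [hcomm τ σ, mul_inv_cancel_right] at this

end General

variable {𝔽 : Type*} [Field 𝔽]

instance isGalois_maxAbelian (P : 𝔽[X]) : IsGalois (RatField 𝔽) (maxAbelian P) := by
  have h : ∀ E : abelianUnramified P, IsGalois (RatField 𝔽) E.1 := fun E => E.2.2.1.toIsGalois
  have h1 : Normal (RatField 𝔽) (⨆ E : abelianUnramified P, E.1 :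
      IntermediateField (RatField 𝔽) (FBar 𝔽)) :=
    IntermediateField.normal_iSup (h := fun E => (h E).to_normal)
  have h2 : Algebra.IsSeparable (RatField 𝔽) (⨆ E : abelianUnramified P, E.1 :
      IntermediateField (RatField 𝔽) (FBar 𝔽)) :=
    IntermediateField.isSeparable_iSup (h := fun E => (h E).to_isSeparable)
  rw [maxAbelian, sSup_eq_iSup']
  exact ⟨⟩

variable (P : 𝔽[X])

theorem exists_prime_liesOver (Q : Place P) (E : IntermediateField (RatField 𝔽) (FBar 𝔽)) :
    ∃ 𝔔 : Ideal (integralClosure 𝔽[X] E), 𝔔.IsPrime ∧ 𝔔.LiesOver (primeIdeal Q.1) := by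
  have : (primeIdeal Q.1).IsPrime :=
    (PrincipalIdealRing.isMaximal_of_irreducible Q.2.1.irreducible).isPrime
  have hinj : Function.Injective (algebraMap 𝔽[X] E) := by
    rw [IsScalarTower.algebraMap_eq 𝔽[X] (RatField 𝔽) E]
    exact (algebraMap (RatField 𝔽) E).injective.comp (RatFunc.algebraMap_injective 𝔽)
  have hinj' : Function.Injective (algebraMap 𝔽[X] (integralClosure 𝔽[X] E)) :=
    Function.Injective.of_comp (f := algebraMap (integralClosure 𝔽[X] E) E) hinj
  have : FaithfulSMul 𝔽[X] (integralClosure 𝔽[X] E) :=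
    (faithfulSMul_iff_algebraMap_injective _ _).2 hinj'
  obtain ⟨𝔔, h1, h2⟩ :=
    (inferInstance : Nonempty ((primeIdeal Q.1).primesOver (integralClosure 𝔽[X] E)))
  exact ⟨𝔔, h1, h2⟩

variable [Fintype 𝔽]

theorem natCard_quotient_primeIdeal {Q : 𝔽[X]} (hQ : Q.Monic) :
    Nat.card (𝔽[X] ⧸ primeIdeal Q) = Fintype.card 𝔽 ^ Q.natDegree := by
  have : Module.Finite 𝔽 (𝔽[X] ⧸ Ideal.span {Q}) := hQ.finite_quotient
  rw [Module.natCard_eq_pow_finrank (K := 𝔽), finrank_quotient_span_eq_natDegree,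
    Nat.card_eq_fintype_card]

theorem exists_isFrobenius (Q : Place P) : ∃ σ : GS P, IsFrobenius P Q σ := by
  obtain ⟨𝔔, _, h𝔔⟩ := exists_prime_liesOver P Q (maxAbelian P)
  have : Finite (𝔽[X] ⧸ 𝔔.under 𝔽[X]) := by
    refine Nat.finite_of_card_ne_zero ?_
    rw [← h𝔔.over, natCard_quotient_primeIdeal Q.2.1.monic]
    exact pow_ne_zero _ Fintype.card_ne_zero
  obtain ⟨σ, hσ⟩ := exists_isArithFrobAt 𝔽[X] (K := RatField 𝔽) 𝔔
  exact ⟨σ, fun 𝔔' _ h𝔔' =>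
    isArithFrobAt_of_under_eq 𝔽[X] (GS_comm P) (h𝔔.over.symm.trans h𝔔'.over) hσ⟩

theorem isFrobenius_frob (Q : Place P) : IsFrobenius P Q (frob P Q) :=
  Classical.epsilon_spec (exists_isFrobenius P Q)

variable [hP : IsMonicPrime P]

/-- The Frobenius at `Q` acts on `𝔭`-power torsion as `Φ_Q`. -/
theorem frob_eq_carlitz (Q : Place P) {n : ℕ} (x : maxAbelian P)
    (hx : (x : FBar 𝔽) ∈ carlitzTorsion (primeIdeal P ^ n)) :
    ((frob P Q x : maxAbelian P) : FBar 𝔽) = carlitz 𝔽 Q.1 x := by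
  let B := integralClosure 𝔽[X] (maxAbelian P)
  let ι : B →ₐ[𝔽[X]] FBar 𝔽 := ((maxAbelian P).val.restrictScalars 𝔽[X]).comp B.val
  have hι : Function.Injective ι := (maxAbelian P).val.injective.comp Subtype.val_injective
  have hxi : IsIntegral 𝔽[X] x :=
    (isIntegral_algHom_iff ((maxAbelian P).val.restrictScalars 𝔽[X])
      (maxAbelian P).val.injective).1 (isIntegral_of_mem_carlitzTorsion P hx)
  let y : B := ⟨x, hxi⟩
  obtain ⟨𝔔, _, h𝔔⟩ := exists_prime_liesOver P Q (maxAbelian P)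
  have : IsScalarTower 𝔽 𝔽[X] B := IsScalarTower.of_algebraMap_eq fun c =>
    hι (IsScalarTower.algebraMap_apply 𝔽 𝔽[X] (FBar 𝔽) c)
  have h1 := isFrobenius_frob P Q 𝔔 h𝔔 y
  rw [← h𝔔.over, natCard_quotient_primeIdeal Q.2.1.monic] at h1
  have hQ : algebraMap 𝔽[X] B Q.1 ∈ 𝔔 := by
    have : Q.1 ∈ 𝔔.under 𝔽[X] := by
      rw [← h𝔔.over]
      exact Ideal.mem_span_singleton_self _
    exact this
  have h2 := carlitzEnd_sub_pow_mem Q.2.1.irreducible Q.2.1.monic 𝔔 hQ y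
  -- Both Fr_Q(y) and Φ_Q(y) are congruent to y^(q^deg Q), so their difference lies in 𝔔. It is also
  -- killed by Φ_{P^n}, and P^n ∉ 𝔔, which forces it to be zero.
  have h3 := 𝔔.sub_mem h1 h2
  rw [sub_sub_sub_cancel_right] at h3
  have h4 : ∀ z : B, ι z ∈ carlitzTorsion (primeIdeal P ^ n) → carlitzEnd 𝔽 B (P ^ n) z = 0 := by
    intro z hz
    apply hι
    rw [map_carlitzEnd, map_zero]
    exact mem_carlitzTorsion_pow.1 hz
  have h5 : ι (frob P Q • y) ∈ carlitzTorsion (primeIdeal P ^ n) := by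
    rw [mem_carlitzTorsion_pow]
    have h6 := map_carlitzEnd 𝔽 (((frob P Q).toAlgHom).restrictScalars 𝔽[X]) (P ^ n) x
    have h7 : carlitzEnd 𝔽 (maxAbelian P) (P ^ n) x = 0 := by
      apply (maxAbelian P).val.injective
      have := map_carlitzEnd 𝔽 ((maxAbelian P).val.restrictScalars 𝔽[X]) (P ^ n) x
      rw [map_zero]
      exact this.trans (mem_carlitzTorsion_pow.1 hx)
    rw [h7, map_zero] at h6
    have h8 := map_carlitzEnd 𝔽 ((maxAbelian P).val.restrictScalars 𝔽[X]) (P ^ n) (frob P Q x)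
    refine h8.symm.trans ?_
    rw [← map_zero ((maxAbelian P).val.restrictScalars 𝔽[X])]
    exact congrArg _ h6.symm
  have h6 : carlitzEnd 𝔽 B (P ^ n) (frob P Q • y - carlitzEnd 𝔽 B Q.1 y) = 0 := by
    rw [map_sub, h4 _ h5, ← carlitzEnd_mul, mul_comm, carlitzEnd_mul, h4 y hx, map_zero, sub_zero]
  have h7 := eq_zero_of_carlitzEnd_eq_zero 𝔔 (algebraMap_notMem_of_liesOver hP Q n 𝔔) h3 h6
  have h8 := congrArg ι (sub_eq_zero.1 h7)
  rw [map_carlitzEnd] at h8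
  exact h8

/-- The cyclotomic character sends the Frobenius at `Q` to `Q`. -/
theorem cyclotomicChar_restriction_frob (Q : Place P) :
    (cyclotomicChar P (restriction P (frob P Q)) : Ap P) = algebraMap 𝔽[X] (Ap P) Q.1 := by
  refine AdicCompletion.ext_evalₐ fun n => ?_
  change red P n _ = red P n _
  obtain ⟨b, hb⟩ := Ideal.Quotient.mk_surjective
    (red P n (cyclotomicChar P (restriction P (frob P Q)) : Ap P))
  have hmem := torsionGenerator_mem P n
  let y : cyclotomicField P := ⟨_, mem_cyclotomicField P hmem⟩
  let x : maxAbelian P := ⟨_, cyclotomicField_le_maxAbelian P y.2⟩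
  have h1 := isCyclotomicCharacter_cyclotomicChar P (restriction P (frob P Q)) n y hmem b hb
  have h2 := isRestriction_restriction P (frob P Q) x y rfl
  have h3 := frob_eq_carlitz P Q x hmem
  rw [← hb, AlgHom.commutes]
  exact mk_eq_of_carlitz_torsionGenerator P (h1.symm.trans (h2.symm.trans h3))

end Frobenius

/-! ### Euler products by sieving -/

section EulerProduct

variable {𝔽 : Type*} [Field 𝔽]

theorem IsMonicPrime.dvd_mul_iff_of_ne {Q Q' : 𝔽[X]} (hQ : IsMonicPrime Q) (hQ' : IsMonicPrime Q')
    (h : Q' ≠ Q) (a : 𝔽[X]) : Q' ∣ Q * a ↔ Q' ∣ a := by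
  rw [hQ'.irreducible.prime.dvd_mul, or_iff_right]
  exact fun hd => h (Polynomial.eq_of_monic_of_associated hQ'.monic hQ.monic
    (hQ'.irreducible.associated_of_dvd hQ.irreducible hd))

variable {R : Type*} [CommRing R]

theorem monomial_eq_C_mul_X_pow (n : ℕ) (r : R) :
    PowerSeries.monomial n r = PowerSeries.C r * PowerSeries.X ^ n := by
  ext m
  rw [PowerSeries.coeff_C_mul, PowerSeries.coeff_X_pow, PowerSeries.coeff_monomial, mul_ite,
    mul_one, mul_zero]

variable [Fintype 𝔽]

open Classical in
/-- The series `∑ f(a) X ^ deg a` over the monic `a` that are divisible by no element of `T`. -/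
def sieveSeries (f : 𝔽[X] →* R) (T : Finset 𝔽[X]) : PowerSeries R :=
  PowerSeries.mk fun n => ∑ a ∈ monicsOfDegree 𝔽 n with ∀ Q ∈ T, ¬ Q ∣ a, f a

theorem sieveSeries_empty (f : 𝔽[X] →* R) :
    sieveSeries f ∅ = PowerSeries.mk fun n => ∑ a ∈ monicsOfDegree 𝔽 n, f a := by
  simp [sieveSeries]

/-- Removing the Euler factor at `Q` removes the multiples of `Q`. -/
theorem one_sub_mul_sieveSeries [DecidableEq 𝔽[X]] (f : 𝔽[X] →* R) {T : Finset 𝔽[X]}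
    (hT : ∀ Q ∈ T, IsMonicPrime Q) {Q : 𝔽[X]} (hQ : IsMonicPrime Q) (hQT : Q ∉ T) :
    (1 - PowerSeries.monomial Q.natDegree (f Q)) * sieveSeries f T =
      sieveSeries f (insert Q T) := by
  classical
  ext n
  have hsplit : PowerSeries.coeff n (sieveSeries f T) =
      PowerSeries.coeff n (sieveSeries f (insert Q T)) +
        ∑ a ∈ monicsOfDegree 𝔽 n with (∀ Q' ∈ T, ¬ Q' ∣ a) ∧ Q ∣ a, f a := by
    rw [sieveSeries, sieveSeries, PowerSeries.coeff_mk, PowerSeries.coeff_mk,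
      ← Finset.sum_filter_add_sum_filter_not _ (fun a => Q ∣ a), add_comm, Finset.filter_filter,
      Finset.filter_filter]
    congr 1
    refine Finset.sum_congr (Finset.filter_congr fun a _ => ?_) fun _ _ => rfl
    rw [Finset.forall_mem_insert, and_comm]
  have hQm : ∑ a ∈ monicsOfDegree 𝔽 n with (∀ Q' ∈ T, ¬ Q' ∣ a) ∧ Q ∣ a, f a =
      PowerSeries.coeff n (PowerSeries.monomial Q.natDegree (f Q) * sieveSeries f T) := by
    rw [monomial_eq_C_mul_X_pow, mul_assoc, PowerSeries.coeff_C_mul, PowerSeries.coeff_X_pow_mul']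
    split_ifs with hn
    · rw [sieveSeries, PowerSeries.coeff_mk, Finset.mul_sum]
      symm
      -- The removed terms are a = Qb with deg b = n - deg Q. As Q ∉ T, a prime of T divides Qb
      -- exactly when it divides b.
      refine Finset.sum_bij (fun b _ => Q * b) ?_ ?_ ?_ ?_
      · intro b hb
        simp only [Finset.mem_filter, mem_monicsOfDegree] at hb ⊢
        refine ⟨⟨hQ.monic.mul hb.1.1, ?_⟩, fun Q' hQ' => ?_, dvd_mul_right _ _⟩
        · rw [hQ.monic.natDegree_mul hb.1.1, hb.1.2]
          omega
        · rw [hQ.dvd_mul_iff_of_ne (hT Q' hQ') (ne_of_mem_of_not_mem hQ' hQT)]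
          exact hb.2 Q' hQ'
      · intro b _ c _ h
        exact mul_left_cancel₀ hQ.monic.ne_zero h
      · intro a ha
        simp only [Finset.mem_filter, mem_monicsOfDegree] at ha
        obtain ⟨⟨ham, han⟩, haT, b, rfl⟩ := ha
        have hb : b.Monic := hQ.monic.of_mul_monic_left ham
        refine ⟨b, ?_, rfl⟩
        simp only [Finset.mem_filter, mem_monicsOfDegree]
        refine ⟨⟨hb, ?_⟩, fun Q' hQ' hd => haT Q' hQ' (hd.mul_left _)⟩
        rw [hQ.monic.natDegree_mul hb] at han
        omega
      · intro b _
        rw [map_mul]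
    · rw [mul_zero]
      refine Finset.sum_eq_zero fun a ha => ?_
      simp only [Finset.mem_filter, mem_monicsOfDegree] at ha
      refine absurd (Polynomial.natDegree_le_of_dvd ha.2.2 ha.1.1.ne_zero) ?_
      omega
  rw [sub_mul, one_mul, map_sub, hsplit, hQm, add_sub_cancel_right]

theorem prod_one_sub_mul_sieveSeries (f : 𝔽[X] →* R) (T : Finset 𝔽[X])
    (hT : ∀ Q ∈ T, IsMonicPrime Q) :
    (∏ Q ∈ T, (1 - PowerSeries.monomial Q.natDegree (f Q))) * sieveSeries f ∅ =
      sieveSeries f T := by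
  classical
  induction T using Finset.induction_on with
  | empty => simp
  | insert Q T hQT ih =>
    rw [Finset.prod_insert hQT, mul_assoc, ih fun Q' hQ' => hT Q' (Finset.mem_insert_of_mem hQ'),
      one_sub_mul_sieveSeries f (fun Q' hQ' => hT Q' (Finset.mem_insert_of_mem hQ'))
        (hT Q (Finset.mem_insert_self _ _)) hQT]

/-- If all primes of degree at most `n` are sieved out, only `a = 1` remains up to degree `n`. -/
theorem coeff_mul_sieveSeries (f : 𝔽[X] →* R) {T : Finset 𝔽[X]} {n : ℕ}
    (hT : ∀ Q ∈ T, IsMonicPrime Q) (hT' : ∀ Q, IsMonicPrime Q → Q.natDegree ≤ n → Q ∈ T)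
    (g : PowerSeries R) :
    PowerSeries.coeff n (g * sieveSeries f T) = PowerSeries.coeff n g := by
  classical
  have h0 : PowerSeries.coeff 0 (sieveSeries f T) = 1 := by
    have : ({a ∈ monicsOfDegree 𝔽 0 | ∀ Q ∈ T, ¬ Q ∣ a} : Finset 𝔽[X]) = {1} := by
      ext a
      simp only [Finset.mem_filter, mem_monicsOfDegree, Finset.mem_singleton]
      refine ⟨fun h => h.1.1.natDegree_eq_zero.1 h.1.2, ?_⟩
      rintro rfl
      exact ⟨⟨Polynomial.monic_one, Polynomial.natDegree_one⟩, fun Q hQ hd =>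
        (hT Q hQ).irreducible.not_isUnit (isUnit_of_dvd_one hd)⟩
    rw [sieveSeries, PowerSeries.coeff_mk, this, Finset.sum_singleton, map_one]
  have hk : ∀ k, k ≠ 0 → k ≤ n → PowerSeries.coeff k (sieveSeries f T) = 0 := by
    intro k hk0 hkn
    rw [sieveSeries, PowerSeries.coeff_mk, Finset.filter_false_of_mem, Finset.sum_empty]
    intro a ha h
    rw [mem_monicsOfDegree] at ha
    have hu : ¬ IsUnit a := fun hu => hk0 (ha.2 ▸ Polynomial.natDegree_eq_zero_of_isUnit hu)
    obtain ⟨Q, hQm, hQi, hQa⟩ := Polynomial.exists_monic_irreducible_factor a hu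
    have := Polynomial.natDegree_le_of_dvd hQa ha.1.ne_zero
    exact h Q (hT' Q ⟨hQm, hQi⟩ (by omega)) hQa
  rw [PowerSeries.coeff_mul, Finset.sum_eq_single (n, 0)]
  · rw [h0, mul_one]
  · rintro ⟨i, k⟩ hik hne
    rw [Finset.HasAntidiagonal.mem_antidiagonal] at hik
    dsimp only at hik ⊢
    rw [hk k ?_ (by omega), mul_zero]
    rintro rfl
    exact hne (by rw [← hik, add_zero])
  · intro h
    exact (h (by simp)).elim

end EulerProduct

/-! ### The quasi-characters on Frobenius elements, and the Stickelberger series -/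

section Characters

variable {𝔽 : Type*} [Field 𝔽] (P : 𝔽[X]) [hP : IsMonicPrime P]

open Classical in
/-- A character of `A_𝔭ˣ` as a multiplicative function on `A`, zero on `𝔭`. -/
def extendChar (χ : (Ap P)ˣ →* (Ap P)ˣ) : 𝔽[X] →* Ap P where
  toFun a := if ha : P ∣ a then 0 else (χ (toUnit P a ha) : Ap P)
  map_one' := by
    have h : ¬ P ∣ 1 := fun h => hP.irreducible.not_isUnit (isUnit_of_dvd_one h)
    have h1 : toUnit P 1 h = 1 := Units.ext (map_one (algebraMap 𝔽[X] (Ap P)))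
    rw [dif_neg h, h1, map_one, Units.val_one]
  map_mul' a b := by
    by_cases ha : P ∣ a
    · rw [dif_pos ha, dif_pos (ha.mul_right b), zero_mul]
    by_cases hb : P ∣ b
    · rw [dif_pos hb, dif_pos (hb.mul_left a), mul_zero]
    have hab : ¬ P ∣ a * b := fun h => (hP.irreducible.prime.dvd_or_dvd h).elim ha hb
    have h1 : toUnit P (a * b) hab = toUnit P a ha * toUnit P b hb :=
      Units.ext (map_mul (algebraMap 𝔽[X] (Ap P)) a b)
    rw [dif_neg ha, dif_neg hb, dif_neg hab, h1, map_mul, Units.val_mul]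

theorem extendChar_of_dvd (χ : (Ap P)ˣ →* (Ap P)ˣ) {a : 𝔽[X]} (ha : P ∣ a) :
    extendChar P χ a = 0 := dif_pos ha

theorem extendChar_of_not_dvd (χ : (Ap P)ˣ →* (Ap P)ˣ) {a : 𝔽[X]} (ha : ¬ P ∣ a) :
    extendChar P χ a = χ (toUnit P a ha) := dif_neg ha

variable [Fintype 𝔽] {p : ℕ} [Fact p.Prime] [CharP 𝔽 p]

/-- This excludes modulus 0, where `ZMod` would be ℤ and `val` an absolute value, so that `val` is
the representative below q^d - 1. -/
theorem neZero_card_sub_one : NeZero (Fintype.card 𝔽 ^ P.natDegree - 1) := by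
  have := Nat.one_lt_pow hP.irreducible.natDegree_pos.ne' (Fintype.one_lt_card (α := 𝔽))
  exact ⟨by omega⟩

theorem units_map_teichmuller_pow_eq_one (u : (Ap P)ˣ) :
    Units.map (teichmuller P : Ap P →* Ap P) u ^ (Fintype.card 𝔽 ^ P.natDegree - 1) = 1 := by
  have hpos : 0 < Fintype.card 𝔽 ^ P.natDegree := pow_pos Fintype.card_pos _
  apply mul_right_cancel (b := Units.map (teichmuller P : Ap P →* Ap P) u)
  rw [← pow_succ, Nat.sub_add_cancel hpos, one_mul]
  exact Units.ext (teichmuller_pow_card P u)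

theorem oneUnitPow_neg_mul (y : ℤ_[p]) (u : (Ap P)ˣ) :
    oneUnitPow P (-y) u * oneUnitPow P y u = 1 := by
  refine Units.ext (AdicCompletion.ext_evalₐ fun n => ?_)
  change red P n _ = red P n _
  rw [Units.val_mul, map_mul, red_oneUnitPow, red_oneUnitPow, ← pow_add, Units.val_one, map_one]
  have h : p ^ n ∣ (-y).appr n + y.appr n := by
    rw [← ZMod.natCast_eq_zero_iff, Nat.cast_add]
    have h1 : PadicInt.toZModPow n (-y) = ((-y).appr n : ZMod (p ^ n)) := rfl
    have h2 : PadicInt.toZModPow n y = (y.appr n : ZMod (p ^ n)) := rfl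
    rw [← h1, ← h2, map_neg, neg_add_cancel]
  obtain ⟨c, hc⟩ := h
  rw [hc, pow_mul, oneUnit_pow, one_pow]

/-- Exponents enter only through natural representatives, so inverting is not formal: those of i and
-i add to a multiple of q^d - 1, which kills ω_𝔭, and those of y and -y modulo p^n add to a multiple
of p^n, which kills one-units modulo 𝔭^n. -/
theorem quasiChar_neg_mul (s : Exponent P p) (u : (Ap P)ˣ) :
    quasiChar P (-s) u * quasiChar P s u = 1 := by
  have := neZero_card_sub_one P
  have h : Fintype.card 𝔽 ^ P.natDegree - 1 ∣ (-s.2).val + s.2.val := by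
    rw [← ZMod.natCast_eq_zero_iff, Nat.cast_add, ZMod.natCast_zmod_val, ZMod.natCast_zmod_val,
      neg_add_cancel]
  obtain ⟨c, hc⟩ := h
  rw [quasiChar, quasiChar, MonoidHom.mul_apply, MonoidHom.mul_apply, MonoidHom.pow_apply,
    MonoidHom.pow_apply, mul_mul_mul_comm, ← pow_add, Prod.snd_neg, Prod.fst_neg, hc, pow_mul,
    units_map_teichmuller_pow_eq_one, one_pow, one_mul, oneUnitPow_neg_mul]

theorem padicL_eq_sieveSeries (y : ℤ_[p]) (i : ZMod (Fintype.card 𝔽 ^ P.natDegree - 1)) :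
    padicL P y i = sieveSeries (extendChar P (quasiChar P (y, i))) ∅ := by
  rw [sieveSeries_empty]
  rfl

/-- The signs in ξ_{-s} and Fr_Q⁻¹ cancel, leaving κ(Fr_Q)^s = Q^s. -/
theorem xi_neg_frob_inv (s : Exponent P p) (Q : Place P) :
    (xi P (-s) (frob P Q)⁻¹ : Ap P) = extendChar P (quasiChar P s) Q.1 := by
  have hQ : ¬ P ∣ Q.1 := fun h => Q.2.2 (Polynomial.eq_of_monic_of_associated Q.2.1.monic hP.monic
    (hP.irreducible.associated_of_dvd Q.2.1.irreducible h).symm)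
  have h1 : cyclotomicChar P (restriction P (frob P Q)) = toUnit P Q.1 hQ :=
    Units.ext (cyclotomicChar_restriction_frob P Q)
  rw [extendChar_of_not_dvd P _ hQ, map_inv, xi, MonoidHom.comp_apply, MonoidHom.comp_apply, h1,
    inv_eq_of_mul_eq_one_right (quasiChar_neg_mul P s _)]

theorem specialize_stickelberger (y : ℤ_[p]) (i : ZMod (Fintype.card 𝔽 ^ P.natDegree - 1)) :
    specialize P (xi P (-(y, i))) (stickelberger P) = padicL P y i := by
  classical
  set α := xi P (-(y, i))
  set f := extendChar P (quasiChar P (y, i))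
  ext1 n
  let T : Finset 𝔽[X] := (placesUpTo P n).image Subtype.val
  have hT : ∀ Q ∈ T, IsMonicPrime Q := by
    intro Q hQ
    obtain ⟨Q, -, rfl⟩ := Finset.mem_image.1 hQ
    exact Q.2.1
  have hPT : P ∉ T := by
    intro h
    obtain ⟨Q, -, hQ⟩ := Finset.mem_image.1 h
    exact Q.2.2 hQ
  have hfac : ∀ Q : Place P, (1 - PowerSeries.monomial Q.1.natDegree (f Q.1)) *
      specialize P α (eulerFactor P Q) = 1 := by
    intro Q
    have := congrArg (specialize P α) (mul_eulerFactor P Q)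
    rw [map_mul, map_sub, map_one] at this
    rw [← this]
    congr 2
    rw [monomial_eq_C_mul_X_pow, monomial_eq_C_mul_X_pow, map_mul, map_pow, specialize,
      PowerSeries.map_X, PowerSeries.map_C, ← xi_neg_frob_inv]
    simp [α]
  have hprod : (∏ Q ∈ T, (1 - PowerSeries.monomial Q.natDegree (f Q))) *
      specialize P α (∏ Q ∈ placesUpTo P n, eulerFactor P Q) = 1 := by
    rw [Finset.prod_image Subtype.val_injective.injOn, map_prod, ← Finset.prod_mul_distrib]
    exact Finset.prod_eq_one fun Q _ => hfac Q
  -- P is not a place outside S, yet the sieve needs every small prime. Since f(P) = 0, its Euler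
  -- factor is 1 and it can be added freely.
  have hsieve : sieveSeries f (insert P T) = sieveSeries f T := by
    rw [← one_sub_mul_sieveSeries f hT hP hPT, extendChar_of_dvd P _ dvd_rfl, map_zero, sub_zero,
      one_mul]
  have hL : padicL P y i = specialize P α (∏ Q ∈ placesUpTo P n, eulerFactor P Q) *
      sieveSeries f (insert P T) := by
    rw [hsieve, ← prod_one_sub_mul_sieveSeries f T hT, ← mul_assoc, mul_comm (specialize P α _),
      hprod, one_mul, padicL_eq_sieveSeries]
  have hcoeff : ∀ g, PowerSeries.coeff n (specialize P α g) =
      (MonoidAlgebra.lift ℤ (Ap P) (GS P) ((Units.coeHom (Ap P)).comp α)) (PowerSeries.coeff n g) :=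
    fun g => PowerSeries.coeff_map _ n g
  rw [hL, coeff_mul_sieveSeries f (n := n), hcoeff, hcoeff,
    ← coeff_stickelberger P n _ (Finset.Subset.refl _)]
  · exact (Finset.forall_mem_insert _ _ _).2 ⟨hP, hT⟩
  · intro Q hQ hn
    by_cases h : Q = P
    · exact h ▸ Finset.mem_insert_self _ _
    · exact Finset.mem_insert_of_mem (Finset.mem_image.2 ⟨⟨Q, hQ, h⟩, by simpa using hn, rfl⟩)

end Characters

/-! ### Vanishing of power sums and polynomiality of Z(X, j) -/

section PowerSums

variable {𝔽 : Type*} [Field 𝔽] [Fintype 𝔽]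

/-- Summing a polynomial of degree less than `k` over a translate of the `𝔽`-span of `k` elements
gives zero. -/
theorem sum_eval_add_eq_zero {R : Type*} [CommRing R] [Algebra 𝔽 R] (k : ℕ) (v : Fin k → R)
    (f : R[X]) (hf : f.degree < k) (x : R) :
    ∑ c : Fin k → 𝔽, f.eval (x + ∑ i, c i • v i) = 0 := by
  induction k generalizing f x with
  | zero =>
    have : f = 0 := by
      rw [← Polynomial.degree_eq_bot]
      exact Nat.WithBot.lt_zero_iff.1 hf
    simp [this]
  | succ k ih =>
    -- Summing over one direction first lowers the degree bound by one: translation does not change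
    -- the coefficient of X^m for m ≥ k, and q equal copies of it add to zero.
    let g : R[X] := ∑ c : 𝔽, f.comp (Polynomial.X + Polynomial.C (c • v 0))
    have hg : ∀ y, g.eval y = ∑ c : 𝔽, f.eval (y + c • v 0) := by
      intro y
      simp only [g, Polynomial.eval_finsetSum, Polynomial.eval_comp, Polynomial.eval_add,
        Polynomial.eval_X, Polynomial.eval_C]
    have hdeg : g.degree < k := by
      rw [Polynomial.degree_lt_iff_coeff_zero]
      intro m hm
      have hH : Polynomial.hasseDeriv m f = Polynomial.C (f.coeff m) := by
        ext n
        rw [Polynomial.hasseDeriv_coeff, Polynomial.coeff_C]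
        split_ifs with hn
        · rw [hn, zero_add, Nat.choose_self, Nat.cast_one, one_mul]
        · rw [(Polynomial.degree_lt_iff_coeff_zero f (k + 1)).1 (by exact_mod_cast hf) (n + m)
            (by omega), mul_zero]
      have hT : ∀ r, (f.comp (Polynomial.X + Polynomial.C r)).coeff m = f.coeff m := by
        intro r
        rw [← Polynomial.taylor_apply, Polynomial.taylor_coeff, hH, Polynomial.eval_C]
      simp only [g, Polynomial.finsetSum_coeff, hT, Finset.sum_const, Finset.card_univ,
        nsmul_eq_mul, natCast_card_eq_zero (𝔽 := 𝔽) R, zero_mul]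
    have h := ih (fun i => v i.succ) g hdeg x
    rw [← (Fin.consEquiv fun _ => 𝔽).sum_comp, Fintype.sum_prod_type, Finset.sum_comm, ← h]
    refine Finset.sum_congr rfl fun c _ => ?_
    rw [hg]
    refine Finset.sum_congr rfl fun b _ => ?_
    congr 1
    simp [Fin.sum_univ_succ, Fin.consEquiv]
    ring

/-- The monic polynomials of degree n form the translate by X^n of the 𝔽-span of 1, …, X^(n-1), the
shape to which the vanishing lemma applies with k = n. -/
theorem powerSum_eq_sum (n j : ℕ) :
    powerSum 𝔽 n j = ∑ c : Fin n → 𝔽,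
      (Polynomial.X ^ n + ∑ i : Fin n, c i • (Polynomial.X : 𝔽[X]) ^ (i : ℕ)) ^ j := by
  let e := (Polynomial.monicEquivDegreeLT (R := 𝔽) n).trans (Polynomial.degreeLTEquiv 𝔽 n).toEquiv
  let _ : Fintype {a : 𝔽[X] // a.Monic ∧ a.natDegree = n} := Fintype.ofEquiv _ e.symm
  rw [powerSum, Finset.sum_subtype _ (fun a => mem_monicsOfDegree), ← e.symm.sum_comp]
  refine Finset.sum_congr rfl fun c _ => congrArg (· ^ j) ?_
  change Polynomial.X ^ n + ∑ i : Fin n, Polynomial.monomial i (c i) = _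
  congr 1
  refine Finset.sum_congr rfl fun i _ => ?_
  rw [← Polynomial.monomial_one_right_eq_X_pow, Polynomial.smul_monomial, smul_eq_mul, mul_one]

theorem powerSum_eq_zero {n j : ℕ} (h : j < n) : powerSum 𝔽 n j = 0 := by
  rw [powerSum_eq_sum]
  have := sum_eval_add_eq_zero (𝔽 := 𝔽) n (fun i => (Polynomial.X : 𝔽[X]) ^ (i : ℕ))
    (Polynomial.X ^ j) ((Polynomial.degree_X_pow_le j).trans_lt (by exact_mod_cast h))
    (Polynomial.X ^ n)
  simpa using this

theorem exists_polynomial_eq_gossZ (j : ℕ) :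
    ∃ W : Polynomial 𝔽[X], (W : PowerSeries 𝔽[X]) = gossZ 𝔽 j := by
  -- Truncation at j + 1 keeps the coefficients up to X^j; the later ones vanish.
  refine ⟨PowerSeries.trunc (j + 1) (gossZ 𝔽 j), ?_⟩
  ext1 n
  rw [Polynomial.coeff_coe, PowerSeries.coeff_trunc]
  split_ifs with h
  · rfl
  · rw [gossZ, PowerSeries.coeff_mk, powerSum_eq_zero (by omega)]

end PowerSums

/-! ### Values at natural numbers and congruences modulo 𝔭 -/

section SpecialValues

variable {𝔽 : Type*} [Field 𝔽] (P : 𝔽[X])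

/-- As 𝔭 is finitely generated, the kernel of A_𝔭 → A/𝔭 is 𝔭A_𝔭, so congruences can be checked after
reduction. -/
theorem congrMod_of_red_eq {f g : PowerSeries (Ap P)}
    (h : ∀ n, red P 1 (PowerSeries.coeff n f) = red P 1 (PowerSeries.coeff n g)) :
    CongrMod P f g := by
  intro n
  have hfg : (primeIdeal P).FG := ⟨{P}, by simp⟩
  rw [← AdicCompletion.ker_evalOneₐ_eq_map _ hfg, RingHom.mem_ker]
  refine (AdicCompletion.factorₐ_evalₐ_one _ _).symm.trans ?_
  rw [map_sub, h n, sub_self, map_zero]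

variable [Fintype 𝔽]

open Classical in
theorem coeff_map_sieveSeries_singleton (j n : ℕ) :
    PowerSeries.coeff n (PowerSeries.map (algebraMap 𝔽[X] (Ap P))
      (sieveSeries (powMonoidHom j : 𝔽[X] →* 𝔽[X]) {P})) =
      ∑ a ∈ monicsOfDegree 𝔽 n, if P ∣ a then 0 else algebraMap 𝔽[X] (Ap P) a ^ j := by
  classical
  rw [PowerSeries.coeff_map, sieveSeries, PowerSeries.coeff_mk, map_sum, Finset.sum_filter]
  refine Finset.sum_congr rfl fun a _ => ?_
  by_cases ha : P ∣ a
  · rw [if_pos ha, if_neg fun h => h P (Finset.mem_singleton_self P) ha]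
  · rw [if_neg ha, if_pos fun Q hQ => (Finset.mem_singleton.1 hQ).symm ▸ ha, powMonoidHom_apply,
      map_pow]

theorem gossZ_eq_sieveSeries (j : ℕ) :
    gossZ 𝔽 j = sieveSeries (powMonoidHom j : 𝔽[X] →* 𝔽[X]) ∅ := by
  rw [sieveSeries_empty]
  rfl

variable [hP : IsMonicPrime P]

theorem one_sub_mul_gossZ (j : ℕ) :
    (1 - PowerSeries.C (P ^ j) * PowerSeries.X ^ P.natDegree) * gossZ 𝔽 j =
      sieveSeries (powMonoidHom j : 𝔽[X] →* 𝔽[X]) {P} := by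
  classical
  have := one_sub_mul_sieveSeries (powMonoidHom j : 𝔽[X] →* 𝔽[X]) (T := ∅)
    (fun Q hQ => (Finset.notMem_empty Q hQ).elim) hP (Finset.notMem_empty P)
  rwa [insert_empty_eq, ← gossZ_eq_sieveSeries, monomial_eq_C_mul_X_pow] at this

variable {p : ℕ} [Fact p.Prime] [CharP 𝔽 p]

theorem coeff_padicL (y : ℤ_[p]) (i : ZMod (Fintype.card 𝔽 ^ P.natDegree - 1)) (n : ℕ) :
    PowerSeries.coeff n (padicL P y i) =
      ∑ a ∈ monicsOfDegree 𝔽 n, extendChar P (quasiChar P (y, i)) a := by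
  rw [padicL_eq_sieveSeries, sieveSeries_empty, PowerSeries.coeff_mk]

theorem teichmuller_mul_oneUnit (u : (Ap P)ˣ) :
    Units.map (teichmuller P : Ap P →* Ap P) u * oneUnit P u = u := by
  simp [oneUnit]

/-- The exponent of ω_𝔭 matters only modulo q^d - 1, so it may be taken to be j; then ω_𝔭(u)^j ⟨u⟩^j
= u^j. -/
theorem quasiChar_natCast {j : ℕ} {i : ZMod (Fintype.card 𝔽 ^ P.natDegree - 1)}
    (h : (j : ZMod _) = i) (u : (Ap P)ˣ) : quasiChar P ((j : ℤ_[p]), i) u = u ^ j := by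
  have := neZero_card_sub_one P
  have h1 : Units.map (teichmuller P : Ap P →* Ap P) u ^ i.val =
      Units.map (teichmuller P : Ap P →* Ap P) u ^ j := by
    rw [← h, ZMod.val_natCast]
    exact (pow_eq_pow_mod j (units_map_teichmuller_pow_eq_one P u)).symm
  rw [quasiChar, MonoidHom.mul_apply, MonoidHom.pow_apply, h1, oneUnitPow_natCast, ← mul_pow,
    teichmuller_mul_oneUnit]

theorem padicL_natCast {j : ℕ} {i : ZMod (Fintype.card 𝔽 ^ P.natDegree - 1)}
    (h : (j : ZMod _) = i) : padicL P (j : ℤ_[p]) i = PowerSeries.map (algebraMap 𝔽[X] (Ap P))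
      ((1 - PowerSeries.C (P ^ j) * PowerSeries.X ^ P.natDegree) * gossZ 𝔽 j) := by
  ext1 n
  rw [one_sub_mul_gossZ, coeff_map_sieveSeries_singleton, coeff_padicL]
  refine Finset.sum_congr rfl fun a _ => ?_
  split_ifs with ha
  · exact extendChar_of_dvd P _ ha
  · rw [extendChar_of_not_dvd P _ ha, quasiChar_natCast P h]
    rfl

theorem red_oneUnitPow_one (y : ℤ_[p]) (u : (Ap P)ˣ) : red P 1 (oneUnitPow P y u : Ap P) = 1 := by
  rw [red_oneUnitPow, red_oneUnit, one_pow]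

theorem red_extendChar_quasiChar (y : ℤ_[p]) (i : ZMod (Fintype.card 𝔽 ^ P.natDegree - 1))
    {a : 𝔽[X]} (ha : ¬ P ∣ a) : red P 1 (extendChar P (quasiChar P (y, i)) a) =
      red P 1 (algebraMap 𝔽[X] (Ap P) a ^ i.val) := by
  rw [extendChar_of_not_dvd P _ ha, quasiChar, MonoidHom.mul_apply, Units.val_mul, map_mul,
    red_oneUnitPow_one, mul_one, MonoidHom.pow_apply, Units.val_pow_eq_pow_val, map_pow, map_pow]
  exact congrArg (· ^ i.val) (teichmuller_congr P _)

theorem congrMod_padicL_of_ne_zero (y : ℤ_[p]) {i : ZMod (Fintype.card 𝔽 ^ P.natDegree - 1)}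
    (hi : i ≠ 0) :
    CongrMod P (padicL P y i) (PowerSeries.map (algebraMap 𝔽[X] (Ap P)) (gossZ 𝔽 i.val)) := by
  refine congrMod_of_red_eq P fun n => ?_
  have := neZero_card_sub_one P
  rw [coeff_padicL, PowerSeries.coeff_map, gossZ, PowerSeries.coeff_mk, powerSum, map_sum, map_sum,
    map_sum]
  refine Finset.sum_congr rfl fun a _ => ?_
  by_cases ha : P ∣ a
  · rw [extendChar_of_dvd P _ ha, map_zero, eq_comm, AlgHom.commutes]
    refine Ideal.Quotient.eq_zero_iff_mem.2 ?_
    rw [pow_one]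
    -- Multiples of P are absent from L_𝔭 but present in Z; their powers a^i vanish modulo 𝔭 because
    -- the representative of i is positive.
    exact Ideal.mem_span_singleton.2 (dvd_pow ha ((ZMod.val_ne_zero i).2 hi))
  · rw [red_extendChar_quasiChar P y i ha, map_pow (algebraMap 𝔽[X] (Ap P))]

/-- Here a^0 = 1 even for multiples of P, so these do not vanish modulo 𝔭 and must be sieved out of
Z by the factor 1 - P^0 X^d. -/
theorem congrMod_padicL_zero (y : ℤ_[p]) :
    CongrMod P (padicL P y 0) (PowerSeries.map (algebraMap 𝔽[X] (Ap P))
      ((1 - PowerSeries.X ^ P.natDegree) * gossZ 𝔽 0)) := by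
  refine congrMod_of_red_eq P fun n => ?_
  have h := one_sub_mul_gossZ P 0
  rw [pow_zero, map_one, one_mul] at h
  rw [h, coeff_map_sieveSeries_singleton, coeff_padicL, map_sum, map_sum]
  refine Finset.sum_congr rfl fun a _ => ?_
  split_ifs with ha
  · rw [extendChar_of_dvd P _ ha]
  · rw [red_extendChar_quasiChar P y 0 ha, ZMod.val_zero]

end SpecialValues

end

end PadicGoss

open PadicGoss
theorem theorem3p6 {p : ℕ} [Fact p.Prime] {𝔽 : Type*} [Field 𝔽] [Fintype 𝔽] [CharP 𝔽 p]
    (P : 𝔽[X]) [IsMonicPrime P] :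
    (∀ (y : ℤ_[p]) (i : ZMod (Fintype.card 𝔽 ^ P.natDegree - 1)),
      specialize P (xi P (-(y, i))) (stickelberger P) = padicL P y i) ∧
    (∀ (j : ℕ) (i : ZMod (Fintype.card 𝔽 ^ P.natDegree - 1)), (j : ZMod _) = i →
      ∃ W : Polynomial 𝔽[X], (W : PowerSeries 𝔽[X]) = gossZ 𝔽 j ∧
        padicL P (j : ℤ_[p]) i = PowerSeries.map (algebraMap 𝔽[X] (Ap P))
          (((1 - Polynomial.C (P ^ j) * Polynomial.X ^ P.natDegree) * W : Polynomial 𝔽[X]) :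
            PowerSeries 𝔽[X])) ∧
    (∀ (y : ℤ_[p]) (i : ZMod (Fintype.card 𝔽 ^ P.natDegree - 1)), i ≠ 0 →
      CongrMod P (padicL P y i) (PowerSeries.map (algebraMap 𝔽[X] (Ap P)) (gossZ 𝔽 i.val))) ∧
    (∀ y : ℤ_[p],
      CongrMod P (padicL P y 0) (PowerSeries.map (algebraMap 𝔽[X] (Ap P))
        ((1 - PowerSeries.X ^ P.natDegree) * gossZ 𝔽 0))) := by
  refine ⟨specialize_stickelberger P, fun j i h => ?_,
    fun y i hi => congrMod_padicL_of_ne_zero P y hi, congrMod_padicL_zero P⟩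
  obtain ⟨W, hW⟩ := exists_polynomial_eq_gossZ (𝔽 := 𝔽) j
  refine ⟨W, hW, ?_⟩
  rw [padicL_natCast P h, Polynomial.coe_mul, hW, Polynomial.coe_sub, Polynomial.coe_mul,
    Polynomial.coe_one, Polynomial.coe_C, Polynomial.coe_pow, Polynomial.coe_X]
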